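/- **Setting.** An $M/M/s$-type system has $s\in\{1,2,\dots\}$ servers, Poisson arrivals of rate $\lambda=s\rho$ with $\rho=1-\gamma/\sqrt s\ge 0$, and service rate $1$ per server. A customer who finds all servers busy and $k\ge0$ customers waiting is admitted with probability $p_s(k)\in[0,1]$ and rejected otherwise; customers who find a free server are always admitted. The number of customers is thus a birth–death process with birth rate $\lambda$ in states $k<s$, birth rate $\lambda\,p_s(k-s)$ in states $k\ge s$, and death rate $\min\{k,s\}$ in state $k$. If $(\pi_k)_{k\ge0}$ is its stationary distribution, put $$D_s(\rho)=\sum_{k\ge s}\pi_k,\qquad D_s^R(\rho)=\sum_{k\ge s}\pi_k\,(1-p_s(k-s)).$$ Let $f:[0,\infty)\to\mathbb R$, and let $$\mathcal L(\gamma)=\int_0^\infty e^{-\gamma x}f(x)\,dx,\qquad \gamma_{\min}=\inf\{\gamma\in\mathbb R:\mathcal L(\gamma)<\infty\}\in[-\infty,\infty).$$ Assume that $f$ is non-negative, non-increasing, $f\in C^4([0,\infty))$, $f(0)=1$, and that for every $\gamma>\gamma_{\min}$ and $j=0,1,2,3,4$ we have $e^{-\gamma x}f^{(j)}(x)\in L^1([0,\infty))$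 and $e^{-\gamma x}f^{(j)}(x)\to0$ as $x\to\infty$. The control is global with scaling profile $f$: $$p_s(0)p_s(1)\cdots p_s(n)=f\Bigl(\frac{n+1}{\sqrt s}\Bigr),\qquad n=0,1,2,\dots$$ With $\phi,\Phi$ the standard normal density and distribution function, put $$g=\frac{\phi}{\Phi},\qquad h(\gamma)=-\tfrac13\bigl(\gamma^3+(\gamma^2+2)g(\gamma)\bigr)g(\gamma),\qquad \mathcal M(\gamma)=\tfrac12\gamma^2\mathcal L'(\gamma)-\tfrac12 ,$$ and $$T_1=\frac{g\mathcal L}{1+g\mathcal L},\qquad T_2=\frac{(h+g^2)\mathcal L+g(\mathcal M+1)}{(1+g\mathcal L)^2},$$ $$T_1^R=\frac{1-\gamma\mathcal L}{1+g\mathcal L}\,g,\qquad T_2^R=\frac{1-\gamma\mathcal L}{1+g\mathcal L}\Bigl(h-\gamma g\,\frac{\gamma\mathcal L+\mathcal M}{1-\gamma\mathcal L}-g\,\frac{h\mathcal L+g\mathcal M}{1+g\mathcal L}\Bigr),$$ all evaluated at $\gamma$. (The denominator $1-\gamma\mathcal L$ vanishes only if $f\equiv1$, in which case $T_1^R=T_2^R=0$.)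 **Theorem (Corrected QED approximations).** For all $s\ge1$ and $\gamma_{\min}<\gamma\le\sqrt s$ the stationary distribution exists and is unique. With $\rho=1-\gamma/\sqrt s$, $$D_s(\rho)=T_1(\gamma)+\frac1{\sqrt s}\,T_2(\gamma)+O\Bigl(\frac1s\Bigr),\qquad D_s^R(\rho)=\frac1{\sqrt s}\,T_1^R(\gamma)+\frac1s\,T_2^R(\gamma)+O\Bigl(\frac1{s\sqrt s}\Bigr),$$ where both error terms are uniform in $\gamma$ on compact subsets of $(\gamma_{\min},\infty)$: for every compact $C\subset(\gamma_{\min},\infty)$ there is a constant $K$ such that, for all integers $s\ge1$ and all $\gamma\in C$ with $\gamma\le\sqrt s$, the errors are at most $K/s$ and $K/(s\sqrt s)$ in absolute value, respectively. -/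

import Mathlib

namespace QEDControl

/-- A smooth scaling profile `f : [0, ∞) → ℝ` lives on `Set.Ici 0` (values at negative reals are
never used). `laplace f γ = ∫₀^∞ e^{-γ x} f(x) dx`. -/
noncomputable def laplace (f : ℝ → ℝ) (γ : ℝ) : ℝ :=
  ∫ x in Set.Ici (0 : ℝ), Real.exp (-γ * x) * f x

/-- The abscissa `γ_min = inf {γ ∈ ℝ | ∫₀^∞ e^{-γ x} f(x) dx < ∞}`, possibly `-∞`. -/
noncomputable def gammaMin (f : ℝ → ℝ) : EReal :=
  sInf ((fun γ : ℝ => (γ : EReal)) ''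
    {γ : ℝ | MeasureTheory.IntegrableOn (fun x => Real.exp (-γ * x) * f x) (Set.Ici (0 : ℝ))})

/-- Smooth scaling profiles: non-negative, non-increasing, `C⁴` on `[0, ∞)` (one-sided derivatives
at `0`), `f 0 = 1`, and for all `γ > γ_min` the functions `e^{-γ x} f⁽ʲ⁾(x)`, `j ≤ 4`, are
integrable on `[0, ∞)` and tend to `0` at infinity. -/
structure IsSmoothScalingProfile (f : ℝ → ℝ) : Prop where
  nonneg : ∀ x, 0 ≤ x → 0 ≤ f x
  antitone : AntitoneOn f (Set.Ici 0)
  map_zero : f 0 = 1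
  contDiffOn : ContDiffOn ℝ 4 f (Set.Ici 0)
  integrable : ∀ γ : ℝ, gammaMin f < (γ : EReal) → ∀ j : ℕ, j ≤ 4 →
    MeasureTheory.IntegrableOn
      (fun x => Real.exp (-γ * x) * iteratedDerivWithin j f (Set.Ici 0) x) (Set.Ici (0 : ℝ))
  tendsto_zero : ∀ γ : ℝ, gammaMin f < (γ : EReal) → ∀ j : ℕ, j ≤ 4 →
    Filter.Tendsto (fun x => Real.exp (-γ * x) * iteratedDerivWithin j f (Set.Ici 0) x)
      Filter.atTop (nhds 0)

/-- `p k` is the probability that a customer who finds all `s` servers busy and `k` customers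
waiting is admitted. The control is global with profile `f` if
`p 0 * ⋯ * p n = f ((n + 1) / √s)` for all `n`. -/
structure IsGlobalControl (f : ℝ → ℝ) (s : ℕ) (p : ℕ → ℝ) : Prop where
  nonneg : ∀ k, 0 ≤ p k
  le_one : ∀ k, p k ≤ 1
  prod_eq : ∀ n : ℕ, ∏ i ∈ Finset.range (n + 1), p i = f (((n : ℝ) + 1) / √(s : ℝ))

/-- Birth rates of the number of customers in the system with arrival rate `lam`. -/
def birthRate (s : ℕ) (lam : ℝ) (p : ℕ → ℝ) (k : ℕ) : ℝ :=
  if k < s then lam else lam * p (k - s)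

/-- Death rates (service rate `1` per server). -/
def deathRate (s : ℕ) (k : ℕ) : ℝ := ((min k s : ℕ) : ℝ)

/-- `π` is a stationary distribution of the birth-death process: a probability distribution on
`ℕ` satisfying the global balance equations. -/
structure IsStationaryDist (s : ℕ) (lam : ℝ) (p : ℕ → ℝ) (π : ℕ → ℝ) : Prop where
  nonneg : ∀ k, 0 ≤ π k
  hasSum_one : HasSum π 1
  balance_zero : birthRate s lam p 0 * π 0 = deathRate s 1 * π 1
  balance_succ : ∀ k, (birthRate s lam p (k + 1) + deathRate s (k + 1)) * π (k + 1) =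
    birthRate s lam p k * π k + deathRate s (k + 2) * π (k + 2)

/-- Stationary probability of delay, `∑_{k ≥ s} π_k`. -/
noncomputable def delayProb (s : ℕ) (π : ℕ → ℝ) : ℝ := ∑' k : ℕ, π (s + k)

/-- Stationary probability of rejection, `∑_{k ≥ s} π_k (1 - p_s(k - s))`. -/
noncomputable def rejectProb (s : ℕ) (p π : ℕ → ℝ) : ℝ := ∑' k : ℕ, π (s + k) * (1 - p k)

/-- `g = φ / Φ`, with `φ` and `Φ` the standard normal density and distribution function. -/
noncomputable def gFun (γ : ℝ) : ℝ :=
  ProbabilityTheory.gaussianPDFReal 0 1 γ /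
    ProbabilityTheory.cdf (ProbabilityTheory.gaussianReal 0 1) γ

/-- `h = -(γ³ + (γ² + 2) g) g / 3`, the coefficient of `1 / s` in the expansion
`B = g / √s + h / s + O(1 / (s √s))` of the Erlang B probability at load `1 - γ / √s`. -/
noncomputable def hFun (γ : ℝ) : ℝ :=
  -(1 / 3) * (γ ^ 3 + (γ ^ 2 + 2) * gFun γ) * gFun γ

/-- `𝓜(γ) = γ² 𝓛'(γ) / 2 - 1 / 2`. -/
noncomputable def mFun (f : ℝ → ℝ) (γ : ℝ) : ℝ :=
  1 / 2 * γ ^ 2 * deriv (laplace f) γ - 1 / 2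

noncomputable def T1 (f : ℝ → ℝ) (γ : ℝ) : ℝ :=
  gFun γ * laplace f γ / (1 + gFun γ * laplace f γ)

noncomputable def T2 (f : ℝ → ℝ) (γ : ℝ) : ℝ :=
  ((hFun γ + gFun γ ^ 2) * laplace f γ + gFun γ * (mFun f γ + 1)) /
    (1 + gFun γ * laplace f γ) ^ 2

noncomputable def T1R (f : ℝ → ℝ) (γ : ℝ) : ℝ :=
  (1 - γ * laplace f γ) / (1 + gFun γ * laplace f γ) * gFun γ

/-- For `γ > γ_min` the denominator `1 - γ 𝓛(γ)` vanishes only if `f = 1` on `[0, ∞)`; then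
`T1R = T2R = 0` by convention, which is also the value of the expression below (its first factor
is `0`). -/
noncomputable def T2R (f : ℝ → ℝ) (γ : ℝ) : ℝ :=
  (1 - γ * laplace f γ) / (1 + gFun γ * laplace f γ) *
    (hFun γ - γ * gFun γ * ((γ * laplace f γ + mFun f γ) / (1 - γ * laplace f γ)) -
      gFun γ * ((hFun γ * laplace f γ + gFun γ * mFun f γ) / (1 + gFun γ * laplace f γ)))

end QEDControl

open QEDControl

/-! Write `δ = 1/√s`, `ρ = 1 - γδ`, `W = ∑ ρ^k f(kδ)`, and let `B` be the Erlang B probability at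
load `sρ`. Detailed balance gives `π_{s+k} = π_s ρ^k f(kδ)`, since the admission probabilities
multiply to `f`. Hence `D = π_s W`. Total mass one reads `π_s (1/B - 1 + W) = 1`
(`IsStationaryDist.normalization`), and a telescoping sum gives `ρ D^R = π_s (1 - γδ W)`
(`IsStationaryDist.rejectProb_eq`). It remains to expand `δW` and `δ/B` to first order in `δ`,
uniformly in `γ`, and to do algebra.

For `δW`, choose `β` with `e^{-βδ} = ρ`. Then `δW` is a Riemann sum of `e^{-βx} f(x)`, and the
trapezoidal rule gives `𝓛(β) + δ/2 + O(δ²)`. Since `β = γ + γ²δ/2 + O(δ²)`, Taylor expansion of `𝓛`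
yields the coefficient `γ²𝓛'(γ)/2 + 1/2 = 𝓜 + 1` (`ExpIntegrable.hasExpansion_waitSum`).

For `δ/B`, an integral representation and Laplace's method reduce everything to the moments `J_n =
∫₀^∞ u^n e^{γu - u²/2} du`. Here `J_0 = Φ/φ = 1/g`, and `J_3` is expressible through `J_0`
(`hasExpansion_erlangInv`).

Uniformity in `γ ∈ C` is carried by the filter `unifAtTop C`. The finitely many small `s` are
handled by the fact that probabilities are at most one (`HasExpansion.exists_uniform_bound`). -/

namespace QEDControl

section

open Filter Asymptotics Topology


/-! ### Calculus of first-order expansions. -/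

/-- `F = a + b δ + O(δ²)` along `l`, with bounded coefficients `a` and `b`. -/
structure HasExpansion {α : Type*} (l : Filter α) (δ F a b : α → ℝ) : Prop where
  left : a =O[l] (fun _ => (1 : ℝ))
  right : b =O[l] (fun _ => (1 : ℝ))
  rem : (fun x => F x - a x - b x * δ x) =O[l] (fun x => δ x ^ 2)

namespace HasExpansion

variable {α : Type*} {l : Filter α} {δ F G a b c d : α → ℝ}

theorem of_eq (ha : a =O[l] (fun _ => (1 : ℝ))) (hb : b =O[l] (fun _ => (1 : ℝ)))
    (h : ∀ x, F x = a x + b x * δ x) : HasExpansion l δ F a b := by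
  refine ⟨ha, hb, ?_⟩
  have : (fun x => F x - a x - b x * δ x) = fun _ => (0 : ℝ) := by
    funext x; rw [h]; ring
  rw [this]
  exact isBigO_zero _ _

theorem add (hF : HasExpansion l δ F a b) (hG : HasExpansion l δ G c d) :
    HasExpansion l δ (fun x => F x + G x) (fun x => a x + c x) (fun x => b x + d x) := by
  refine ⟨hF.left.add hG.left, hF.right.add hG.right, ?_⟩
  refine (hF.rem.add hG.rem).congr_left fun x => ?_
  ring

theorem sub_left_isBigO (hδ : Tendsto δ l (𝓝 0)) (hF : HasExpansion l δ F a b) :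
    (fun x => F x - a x) =O[l] δ := by
  have h1 : (fun x => δ x ^ 2) =O[l] δ := by
    have := (hδ.isBigO_one ℝ).mul (isBigO_refl δ l)
    simpa [pow_two] using this
  have h2 : (fun x => b x * δ x) =O[l] δ := by
    simpa using hF.right.mul (isBigO_refl δ l)
  refine ((hF.rem.trans h1).add h2).congr_left fun x => ?_
  ring

theorem isBigO_one (hδ : Tendsto δ l (𝓝 0)) (hF : HasExpansion l δ F a b) :
    F =O[l] (fun _ => (1 : ℝ)) := by
  refine (((hF.sub_left_isBigO hδ).trans (hδ.isBigO_one ℝ)).add hF.left).congr_left fun x => ?_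
  ring

theorem mul (hδ : Tendsto δ l (𝓝 0)) (hF : HasExpansion l δ F a b)
    (hG : HasExpansion l δ G c d) :
    HasExpansion l δ (fun x => F x * G x) (fun x => a x * c x)
      (fun x => a x * d x + b x * c x) := by
  refine ⟨by simpa using hF.left.mul hG.left,
    by simpa using (hF.left.mul hG.right).add (hF.right.mul hG.left), ?_⟩
  -- The remainder of the product splits as `(F - a - bδ) G + a (G - c - dδ) + bδ (G - c)`.
  have h1 := hF.rem.mul (hG.isBigO_one hδ)
  have h2 := hF.left.mul hG.rem
  have h3 := (hF.right.mul (isBigO_refl δ l)).mul (hG.sub_left_isBigO hδ)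
  have h1' : (fun x => (F x - a x - b x * δ x) * G x) =O[l] (fun x => δ x ^ 2) := by
    simpa using h1
  have h2' : (fun x => a x * (G x - c x - d x * δ x)) =O[l] (fun x => δ x ^ 2) := by
    simpa using h2
  have h3' : (fun x => b x * δ x * (G x - c x)) =O[l] (fun x => δ x ^ 2) := by
    simpa [pow_two] using h3
  refine ((h1'.add h2').add h3').congr_left fun x => ?_
  ring

/-- The remainder equals `F⁻¹ a⁻² (bδ (F - a) - a (F - a - bδ))`. The uniform lower bound `m` keeps
both `a⁻¹` and `F⁻¹` bounded, the latter because `F ≥ m/2` eventually. -/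
theorem inv (hδ : Tendsto δ l (𝓝 0)) (hF : HasExpansion l δ F a b) {m : ℝ} (hm : 0 < m)
    (ha : ∀ᶠ x in l, m ≤ a x) :
    HasExpansion l δ (fun x => (F x)⁻¹) (fun x => (a x)⁻¹) (fun x => -b x * (a x)⁻¹ ^ 2) := by
  have hdiff : Tendsto (fun x => F x - a x) l (𝓝 0) :=
    (hF.sub_left_isBigO hδ).trans_tendsto hδ
  have hFm : ∀ᶠ x in l, m / 2 ≤ F x := by
    filter_upwards [ha, hdiff.eventually (lt_mem_nhds (show -(m / 2) < 0 by linarith))]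
      with x h1 h2
    linarith
  have inv_bdd : ∀ {u : α → ℝ} {r : ℝ}, 0 < r → (∀ᶠ x in l, r ≤ u x) →
      (fun x => (u x)⁻¹) =O[l] (fun _ => (1 : ℝ)) := by
    intro u r hr hu
    refine IsBigO.of_bound r⁻¹ ?_
    filter_upwards [hu] with x hx
    rw [norm_inv, Real.norm_of_nonneg (hr.le.trans hx), norm_one, mul_one]
    exact inv_anti₀ hr hx
  have hai := inv_bdd hm ha
  have hFi := inv_bdd (half_pos hm) hFm
  have hai2 : (fun x => (a x)⁻¹ ^ 2) =O[l] (fun _ => (1 : ℝ)) := by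
    simpa using hai.pow 2
  refine ⟨hai, by simpa using hF.right.neg_left.mul hai2, ?_⟩
  have h1 : (fun x => a x * (F x - a x - b x * δ x)) =O[l] (fun x => δ x ^ 2) := by
    simpa using hF.left.mul hF.rem
  have h2 : (fun x => b x * δ x * (F x - a x)) =O[l] (fun x => δ x ^ 2) := by
    simpa [pow_two] using (hF.right.mul (isBigO_refl δ l)).mul (hF.sub_left_isBigO hδ)
  have h3 : (fun x => (F x)⁻¹ * (a x)⁻¹ ^ 2 *
      (b x * δ x * (F x - a x) - a x * (F x - a x - b x * δ x))) =O[l] (fun x => δ x ^ 2) := by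
    simpa using (hFi.mul hai2).mul (h2.sub h1)
  refine h3.congr' ?_ EventuallyEq.rfl
  filter_upwards [ha, hFm] with x h4 h5
  have h6 : a x ≠ 0 := by linarith
  have h7 : F x ≠ 0 := by linarith
  field_simp
  ring

end HasExpansion


/-! ### Stationary distribution of the birth–death process. -/

/-- The unnormalized solution of the detailed balance equations. -/
noncomputable def weight (s : ℕ) (lam : ℝ) (p : ℕ → ℝ) (k : ℕ) : ℝ :=
  ∏ i ∈ Finset.range k, birthRate s lam p i / deathRate s (i + 1)

theorem deathRate_pos {s : ℕ} (hs : 1 ≤ s) (k : ℕ) : 0 < deathRate s (k + 1) := by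
  unfold deathRate
  have : 0 < min (k + 1) s := by omega
  exact_mod_cast this

/-- The net flow across the cut below state `0` is zero, and the balance equation at each state
carries this to the next cut. -/
theorem IsStationaryDist.detailed_balance {s : ℕ} {lam : ℝ} {p π : ℕ → ℝ}
    (h : IsStationaryDist s lam p π) (k : ℕ) :
    birthRate s lam p k * π k = deathRate s (k + 1) * π (k + 1) := by
  induction k with
  | zero => exact h.balance_zero
  | succ k ih =>
    have := h.balance_succ k
    show _ = deathRate s (k + 2) * π (k + 2)
    linarith

theorem IsStationaryDist.eq_weight {s : ℕ} (hs : 1 ≤ s) {lam : ℝ} {p π : ℕ → ℝ}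
    (h : IsStationaryDist s lam p π) (k : ℕ) : π k = π 0 * weight s lam p k := by
  induction k with
  | zero => simp [weight]
  | succ k ih =>
    have h1 := h.detailed_balance k
    have h2 := deathRate_pos hs k
    rw [weight, Finset.prod_range_succ, ← mul_assoc]
    change _ = π 0 * weight s lam p k * _
    rw [← ih]
    field_simp
    linarith

theorem birthRate_nonneg {s : ℕ} {lam : ℝ} (hlam : 0 ≤ lam) {p : ℕ → ℝ} (hp : ∀ k, 0 ≤ p k)
    (k : ℕ) : 0 ≤ birthRate s lam p k := by
  unfold birthRate
  split_ifs
  · exact hlam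
  · exact mul_nonneg hlam (hp _)

theorem weight_nonneg {s : ℕ} (hs : 1 ≤ s) {lam : ℝ} (hlam : 0 ≤ lam) {p : ℕ → ℝ}
    (hp : ∀ k, 0 ≤ p k) (k : ℕ) : 0 ≤ weight s lam p k :=
  Finset.prod_nonneg fun i _ => div_nonneg (birthRate_nonneg hlam hp i) (deathRate_pos hs i).le

theorem weight_succ {s : ℕ} (hs : 1 ≤ s) (lam : ℝ) (p : ℕ → ℝ) (k : ℕ) :
    deathRate s (k + 1) * weight s lam p (k + 1) = birthRate s lam p k * weight s lam p k := by
  have h2 := deathRate_pos hs k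
  rw [weight, Finset.prod_range_succ]
  change _ * (weight s lam p k * _) = _
  field_simp

theorem existsUnique_isStationaryDist {s : ℕ} (hs : 1 ≤ s) {lam : ℝ} (hlam : 0 ≤ lam)
    {p : ℕ → ℝ} (hp : ∀ k, 0 ≤ p k) (hsum : Summable (weight s lam p)) :
    ∃! π : ℕ → ℝ, IsStationaryDist s lam p π := by
  have hw := weight_nonneg hs hlam hp
  have hpos : 0 < ∑' k, weight s lam p k :=
    hsum.tsum_pos hw 0 (by simp [weight])
  refine ⟨fun k => weight s lam p k / ∑' j, weight s lam p j, ⟨?_, ?_, ?_, ?_⟩, ?_⟩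
  · exact fun k => div_nonneg (hw k) hpos.le
  · have := hsum.hasSum.div_const (∑' j, weight s lam p j)
    rwa [div_self hpos.ne'] at this
  · rw [← mul_div_assoc, ← mul_div_assoc, ← weight_succ hs]
  · intro k
    have h1 := weight_succ hs lam p k
    have h2 := weight_succ hs lam p (k + 1)
    rw [← mul_div_assoc, ← mul_div_assoc, ← mul_div_assoc, ← add_div]
    congr 1
    rw [← h1]
    change _ = _ + deathRate s (k + 1 + 1) * weight s lam p (k + 1 + 1)
    rw [h2]
    ring
  · intro π hπ
    have h1 : π = fun k => π 0 * weight s lam p k := funext (hπ.eq_weight hs)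
    have h2 : HasSum π (π 0 * ∑' j, weight s lam p j) := by
      rw [h1]
      simpa [weight] using hsum.hasSum.mul_left (π 0)
    have h3 := h2.unique hπ.hasSum_one
    funext k
    rw [hπ.eq_weight hs k]
    field_simp
    linear_combination weight s lam p k * h3

/-- From state `s` upward all servers are busy, so step `s + i` multiplies the weight by `(lam / s)
p_i`. -/
theorem weight_add {s : ℕ} (lam : ℝ) (p : ℕ → ℝ) (k : ℕ) :
    weight s lam p (s + k) =
      weight s lam p s * ((lam / s) ^ k * ∏ i ∈ Finset.range k, p i) := by
  unfold weight
  rw [Finset.prod_range_add]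
  congr 1
  rw [← Finset.card_range k, ← Finset.prod_const, Finset.card_range, ← Finset.prod_mul_distrib]
  refine Finset.prod_congr rfl fun i _ => ?_
  have h1 : min (s + i + 1) s = s := by omega
  simp only [birthRate, deathRate, h1, add_tsub_cancel_left]
  rw [if_neg (by omega)]
  ring

theorem weight_of_le {s : ℕ} (lam : ℝ) (p : ℕ → ℝ) {k : ℕ} (hk : k ≤ s) :
    weight s lam p k = lam ^ k / (k.factorial : ℝ) := by
  induction k with
  | zero => simp [weight]
  | succ k ih =>
    have h1 : min (k + 1) s = k + 1 := by omega
    rw [weight, Finset.prod_range_succ]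
    change weight s lam p k * _ = _
    rw [ih (by omega)]
    simp only [birthRate, deathRate, h1, if_pos (show k < s by omega)]
    rw [Nat.factorial_succ]
    push_cast
    have : (k.factorial : ℝ) ≠ 0 := by positivity
    field_simp
    ring

/-! ### Exact formulas for delay and rejection. -/

theorem IsGlobalControl.prod_range {f : ℝ → ℝ} (hf0 : f 0 = 1) {s : ℕ} {p : ℕ → ℝ}
    (hp : IsGlobalControl f s p) (k : ℕ) :
    ∏ i ∈ Finset.range k, p i = f (k / √(s : ℝ)) := by
  cases k with
  | zero => simp [hf0]
  | succ n => rw [hp.prod_eq]; push_cast; rfl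

/-- `∑ₖ ρᵏ f(k / √s)` with `ρ = 1 - γ / √s`. -/
noncomputable def waitSum (f : ℝ → ℝ) (s : ℕ) (γ : ℝ) : ℝ :=
  ∑' k : ℕ, (1 - γ / √(s : ℝ)) ^ k * f (k / √(s : ℝ))

/-- The reciprocal of the Erlang B probability with `s` servers and load `lam`. -/
noncomputable def erlangInv (s : ℕ) (lam : ℝ) : ℝ :=
  ∑ k ∈ Finset.range (s + 1), (s.factorial : ℝ) / (k.factorial : ℝ) * lam ^ k / lam ^ s

theorem load_div {s : ℕ} (hs : 1 ≤ s) (γ : ℝ) :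
    (s : ℝ) * (1 - γ / √(s : ℝ)) / s = 1 - γ / √(s : ℝ) := by
  have : (s : ℝ) ≠ 0 := by positivity
  field_simp

theorem load_nonneg {s : ℕ} (hs : 1 ≤ s) {γ : ℝ} (hγ : γ ≤ √(s : ℝ)) :
    0 ≤ 1 - γ / √(s : ℝ) := by
  have : 0 < √(s : ℝ) := by positivity
  rw [sub_nonneg, div_le_one this]
  exact hγ

theorem weight_add_load {f : ℝ → ℝ} (hf0 : f 0 = 1) {s : ℕ} (hs : 1 ≤ s) (γ : ℝ) {p : ℕ → ℝ}
    (hp : IsGlobalControl f s p) (k : ℕ) :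
    weight s (s * (1 - γ / √(s : ℝ))) p (s + k) =
      weight s (s * (1 - γ / √(s : ℝ))) p s *
        ((1 - γ / √(s : ℝ)) ^ k * f (k / √(s : ℝ))) := by
  rw [weight_add, load_div hs, hp.prod_range hf0]

theorem summable_weight {f : ℝ → ℝ} (hf0 : f 0 = 1) {s : ℕ} (hs : 1 ≤ s) {γ : ℝ} {p : ℕ → ℝ}
    (hp : IsGlobalControl f s p)
    (h : Summable fun k : ℕ => (1 - γ / √(s : ℝ)) ^ k * f (k / √(s : ℝ))) :
    Summable (weight s (s * (1 - γ / √(s : ℝ))) p) := by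
  rw [← summable_nat_add_iff s]
  refine (h.mul_left (weight s (s * (1 - γ / √(s : ℝ))) p s)).congr fun k => ?_
  rw [add_comm k s, weight_add_load hf0 hs γ hp]

section formulas

variable {f : ℝ → ℝ} {s : ℕ} {γ : ℝ} {p π : ℕ → ℝ}

theorem IsStationaryDist.add_eq (hf0 : f 0 = 1) (hs : 1 ≤ s)
    (hp : IsGlobalControl f s p) (hπ : IsStationaryDist s (s * (1 - γ / √(s : ℝ))) p π) (k : ℕ) :
    π (s + k) = π s * ((1 - γ / √(s : ℝ)) ^ k * f (k / √(s : ℝ))) := by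
  rw [hπ.eq_weight hs, hπ.eq_weight hs s, weight_add_load hf0 hs γ hp]
  ring

theorem IsStationaryDist.delayProb_eq (hf0 : f 0 = 1) (hs : 1 ≤ s)
    (hp : IsGlobalControl f s p) (hπ : IsStationaryDist s (s * (1 - γ / √(s : ℝ))) p π) :
    delayProb s π = π s * waitSum f s γ := by
  unfold delayProb waitSum
  rw [← tsum_mul_left]
  exact tsum_congr fun k => hπ.add_eq hf0 hs hp k

/-- In units of `π_s`, the states up to `s` have mass `erlangInv` and those from `s` on have mass
`waitSum`; the `-1` removes the double count of `s`. Strictness of `γ < √s` keeps the load positive,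
so that one may divide by `lam ^ s`. -/
theorem IsStationaryDist.normalization (hf0 : f 0 = 1) (hs : 1 ≤ s) (hγ : γ < √(s : ℝ))
    (hp : IsGlobalControl f s p) (hπ : IsStationaryDist s (s * (1 - γ / √(s : ℝ))) p π) :
    π s * (erlangInv s (s * (1 - γ / √(s : ℝ))) - 1 + waitSum f s γ) = 1 := by
  set lam := (s : ℝ) * (1 - γ / √(s : ℝ)) with hlam
  have hs0 : (0 : ℝ) < s := by positivity
  have hl : 0 < lam := by
    have : 0 < √(s : ℝ) := by positivity
    have : γ / √(s : ℝ) < 1 := by rwa [div_lt_one this]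
    exact mul_pos hs0 (by linarith)
  have h1 := hπ.hasSum_one.summable.sum_add_tsum_nat_add s
  rw [hπ.hasSum_one.tsum_eq] at h1
  have h2 : ∑' i, π (i + s) = π s * waitSum f s γ := by
    rw [← hπ.delayProb_eq hf0 hs hp]
    unfold delayProb
    exact tsum_congr fun k => by rw [add_comm]
  have h3 : ∀ k ≤ s, π k = π s * ((s.factorial : ℝ) / (k.factorial : ℝ) * lam ^ k / lam ^ s) := by
    intro k hk
    rw [hπ.eq_weight hs, hπ.eq_weight hs s, weight_of_le lam p hk, weight_of_le lam p le_rfl]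
    have : (s.factorial : ℝ) ≠ 0 := by positivity
    have : (k.factorial : ℝ) ≠ 0 := by positivity
    field_simp
  have h4 : π s * erlangInv s lam = ∑ k ∈ Finset.range s, π k + π s := by
    rw [erlangInv, Finset.mul_sum, Finset.sum_range_succ, ← h3 s le_rfl]
    congr 1
    exact Finset.sum_congr rfl fun k hk => (h3 k (Finset.mem_range.1 hk).le).symm
  rw [h2] at h1
  linear_combination h1 + h4

/-- With `a_k = ρ^k f(k/√s)` one has `a_{k+1} = ρ a_k p_k`. Thus `ρ` times the `k`-th term is `π_s
(ρ a_k - a_{k+1})`, and the sum is `ρW - (W - 1)`. Keeping `ρ` on the left avoids dividing by it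
when it vanishes. -/
theorem IsStationaryDist.rejectProb_eq (hf0 : f 0 = 1) (hs : 1 ≤ s)
    (hp : IsGlobalControl f s p) (hπ : IsStationaryDist s (s * (1 - γ / √(s : ℝ))) p π)
    (hsum : Summable fun k : ℕ => (1 - γ / √(s : ℝ)) ^ k * f (k / √(s : ℝ))) :
    (1 - γ / √(s : ℝ)) * rejectProb s p π = π s * (1 - γ / √(s : ℝ) * waitSum f s γ) := by
  have h1 : ∀ k, (1 - γ / √(s : ℝ)) * (π (s + k) * (1 - p k)) =
      π s * ((1 - γ / √(s : ℝ)) * ((1 - γ / √(s : ℝ)) ^ k * f (k / √(s : ℝ))) -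
        (1 - γ / √(s : ℝ)) ^ (k + 1) * f ((k + 1 : ℕ) / √(s : ℝ))) := by
    intro k
    rw [hπ.add_eq hf0 hs hp, ← hp.prod_range hf0 (k + 1), Finset.prod_range_succ,
      hp.prod_range hf0 k]
    ring
  have h2 := hsum.tsum_eq_zero_add
  have h3 := (summable_nat_add_iff 1).2 hsum
  unfold rejectProb
  rw [← tsum_mul_left, tsum_congr h1, tsum_mul_left, (hsum.mul_left _).tsum_sub h3, tsum_mul_left]
  simp only [pow_zero, Nat.cast_zero, zero_div, hf0, mul_one] at h2
  change waitSum f s γ = _ at h2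
  change π s * ((1 - γ / √(s : ℝ)) * waitSum f s γ - _) = _
  rw [← sub_eq_iff_eq_add'.2 h2]
  ring

theorem IsStationaryDist.delayProb_mem (hπ : IsStationaryDist s (s * (1 - γ / √(s : ℝ))) p π) :
    delayProb s π ∈ Set.Icc (0 : ℝ) 1 := by
  have h := hπ.hasSum_one.summable.sum_add_tsum_nat_add s
  rw [hπ.hasSum_one.tsum_eq] at h
  have h2 : ∑' i, π (i + s) = delayProb s π := by
    unfold delayProb
    exact tsum_congr fun k => by rw [add_comm]
  have h3 : 0 ≤ ∑ k ∈ Finset.range s, π k := Finset.sum_nonneg fun i _ => hπ.nonneg i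
  exact ⟨tsum_nonneg fun k => hπ.nonneg _, by linarith⟩

theorem IsStationaryDist.rejectProb_mem (hp : IsGlobalControl f s p)
    (hπ : IsStationaryDist s (s * (1 - γ / √(s : ℝ))) p π) :
    rejectProb s p π ∈ Set.Icc (0 : ℝ) 1 := by
  have h0 : Summable fun k => π (s + k) := by
    simpa [add_comm] using (summable_nat_add_iff s).2 hπ.hasSum_one.summable
  have hn : ∀ k, 0 ≤ π (s + k) * (1 - p k) := fun k =>
    mul_nonneg (hπ.nonneg _) (by linarith [hp.le_one k])
  have hle : ∀ k, π (s + k) * (1 - p k) ≤ π (s + k) := fun k =>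
    mul_le_of_le_one_right (hπ.nonneg _) (by linarith [hp.nonneg k])
  refine ⟨tsum_nonneg hn, ?_⟩
  exact ((h0.of_nonneg_of_le hn hle).tsum_le_tsum hle h0).trans hπ.delayProb_mem.2

end formulas

open MeasureTheory Set


/-! ### Trapezoidal rule on the half-line. -/

/-- The error is the integral of `F''` against the Peano kernel `(x - a)(x - b)/2`, which is at most
`(b - a)²/8` in absolute value. Measuring `F''` in `L¹` lets the errors of successive panels add up
to an integral over the half-line. -/
theorem abs_integral_sub_trapezoid_le {F F1 F2 : ℝ → ℝ} {a b : ℝ} (hab : a ≤ b)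
    (hF : ContinuousOn F (Icc a b)) (hF1 : ContinuousOn F1 (Icc a b))
    (hd : ∀ x ∈ Ioo a b, HasDerivAt F (F1 x) x) (hd1 : ∀ x ∈ Ioo a b, HasDerivAt F1 (F2 x) x)
    (hF2 : IntervalIntegrable F2 volume a b) :
    |(∫ x in a..b, F x) - (b - a) / 2 * (F a + F b)| ≤ (b - a) ^ 2 / 8 * ∫ x in a..b, |F2 x| := by
  have hFi : IntervalIntegrable F volume a b := by
    apply ContinuousOn.intervalIntegrable
    rwa [uIcc_of_le hab]
  have hq : IntervalIntegrable (fun x => (x - a) * (x - b) / 2 * F2 x) volume a b :=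
    hF2.continuousOn_mul (by fun_prop)
  have key : ∫ x in a..b, ((x - a) * (x - b) / 2 * F2 x - F x) =
      ((b - a) * (b - b) / 2 * F1 b - (2 * b - a - b) / 2 * F b) -
        ((a - a) * (a - b) / 2 * F1 a - (2 * a - a - b) / 2 * F a) := by
    refine intervalIntegral.integral_eq_sub_of_hasDerivAt_of_le hab
      (f := fun x => (x - a) * (x - b) / 2 * F1 x - (2 * x - a - b) / 2 * F x) ?_ ?_ (hq.sub hFi)
    · exact (ContinuousOn.mul (by fun_prop) hF1).sub (ContinuousOn.mul (by fun_prop) hF)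
    · intro x hx
      have h1 : HasDerivAt (fun x : ℝ => (x - a) * (x - b) / 2)
          ((1 * (x - b) + (x - a) * 1) / 2) x :=
        (((hasDerivAt_id x).sub_const a).mul ((hasDerivAt_id x).sub_const b)).div_const 2
      have h2 : HasDerivAt (fun x : ℝ => (2 * x - a - b) / 2) (2 * 1 / 2) x :=
        ((((hasDerivAt_id x).const_mul 2).sub_const a).sub_const b).div_const 2
      refine ((h1.mul (hd1 x hx)).sub (h2.mul (hd x hx))).congr_deriv ?_
      ring
  rw [intervalIntegral.integral_sub hq hFi] at key
  have h3 : (∫ x in a..b, F x) - (b - a) / 2 * (F a + F b) =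
      ∫ x in a..b, (x - a) * (x - b) / 2 * F2 x := by linear_combination -key
  rw [h3, ← intervalIntegral.integral_const_mul]
  refine (intervalIntegral.abs_integral_le_integral_abs hab).trans ?_
  refine intervalIntegral.integral_mono_on hab hq.abs (hF2.abs.const_mul _) fun x hx => ?_
  rw [abs_mul]
  refine mul_le_mul_of_nonneg_right ?_ (abs_nonneg _)
  rw [abs_le]
  constructor
  · nlinarith [sq_nonneg (2 * x - a - b)]
  · nlinarith [mul_nonneg (sub_nonneg.2 hx.1) (sub_nonneg.2 hx.2), sq_nonneg (b - a)]

/-- The trapezoidal rule gives the two end nodes weight `δ/2`. The sum over `range N` counts the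
node `0` with weight `δ` and omits the node `Nδ`; the two extra terms correct this. -/
theorem abs_integral_sub_sum_range_le {F F1 F2 : ℝ → ℝ}
    (hF : ContinuousOn F (Ici 0)) (hF1 : ContinuousOn F1 (Ici 0))
    (hd : ∀ x, 0 < x → HasDerivAt F (F1 x) x) (hd1 : ∀ x, 0 < x → HasDerivAt F1 (F2 x) x)
    (hF2 : IntegrableOn F2 (Ici 0)) {δ : ℝ} (hδ : 0 ≤ δ) (N : ℕ) :
    |(∫ x in (0 : ℝ)..N * δ, F x) - δ * ∑ k ∈ Finset.range N, F (k * δ) + δ / 2 * F 0 -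
      δ / 2 * F (N * δ)| ≤ δ ^ 2 / 8 * ∫ x in (0 : ℝ)..N * δ, |F2 x| := by
  have hFi : ∀ {a b : ℝ}, 0 ≤ a → 0 ≤ b → IntervalIntegrable F volume a b := by
    intro a b ha hb
    refine (hF.mono ?_).intervalIntegrable
    intro x hx
    exact (le_min ha hb).trans hx.1
  have hF2i : ∀ {a b : ℝ}, 0 ≤ a → 0 ≤ b → IntervalIntegrable F2 volume a b := by
    intro a b ha hb
    rw [intervalIntegrable_iff]
    refine hF2.mono_set ?_
    intro x hx
    exact (le_min ha hb).trans hx.1.le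
  induction N with
  | zero => simp
  | succ N ih =>
    have h0 : 0 ≤ (N : ℝ) * δ := by positivity
    have h1 : (N : ℝ) * δ ≤ ((N + 1 : ℕ) : ℝ) * δ := by push_cast; nlinarith
    have hsub : Icc ((N : ℝ) * δ) (((N + 1 : ℕ) : ℝ) * δ) ⊆ Ici 0 := fun x hx => h0.trans hx.1
    have h2 := abs_integral_sub_trapezoid_le h1 (hF.mono hsub) (hF1.mono hsub)
      (fun x hx => hd x (h0.trans_lt hx.1)) (fun x hx => hd1 x (h0.trans_lt hx.1))
      (hF2i h0 (h0.trans h1))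
    have h3 : ((N + 1 : ℕ) : ℝ) * δ - N * δ = δ := by push_cast; ring
    rw [h3] at h2
    rw [← intervalIntegral.integral_add_adjacent_intervals (hFi le_rfl h0) (hFi h0 (h0.trans h1)),
      ← intervalIntegral.integral_add_adjacent_intervals (hF2i le_rfl h0).abs
        (hF2i h0 (h0.trans h1)).abs, mul_add, Finset.sum_range_succ]
    refine le_trans (le_of_eq ?_) ((abs_add_le _ _).trans (add_le_add ih h2))
    congr 1
    ring

theorem summable_and_abs_integral_sub_tsum_le {F F1 F2 : ℝ → ℝ}
    (hF : ContinuousOn F (Ici 0)) (hF1 : ContinuousOn F1 (Ici 0))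
    (hd : ∀ x, 0 < x → HasDerivAt F (F1 x) x) (hd1 : ∀ x, 0 < x → HasDerivAt F1 (F2 x) x)
    (hFint : IntegrableOn F (Ici 0)) (hF2 : IntegrableOn F2 (Ici 0)) (hF0 : ∀ x, 0 ≤ x → 0 ≤ F x)
    {δ : ℝ} (hδ : 0 < δ) :
    Summable (fun k : ℕ => F (k * δ)) ∧
      |(∫ x in Ici 0, F x) - δ * ∑' k : ℕ, F (k * δ) + δ / 2 * F 0| ≤
        δ ^ 2 / 8 * ∫ x in Ici 0, |F2 x| := by
  have hmain := abs_integral_sub_sum_range_le hF hF1 hd hd1 hF2 hδ.le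
  have hint : ∀ {G : ℝ → ℝ} (N : ℕ), IntegrableOn G (Ici 0) → (∀ x, 0 ≤ x → 0 ≤ G x) →
      ∫ x in (0 : ℝ)..N * δ, G x ≤ ∫ x in Ici 0, G x := by
    intro G N hG h0
    rw [intervalIntegral.integral_of_le (by positivity)]
    refine setIntegral_mono_set hG ?_ ?_
    · exact (ae_restrict_iff' measurableSet_Ici).2 (Eventually.of_forall h0)
    · exact LE.le.eventuallyLE (show Ioc 0 ((N : ℝ) * δ) ⊆ Ici 0 from fun x hx => hx.1.le)
  have hmain' : ∀ N : ℕ, |(∫ x in (0 : ℝ)..N * δ, F x) - δ * ∑ k ∈ Finset.range N, F (k * δ) +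
      δ / 2 * F 0 - δ / 2 * F (N * δ)| ≤ δ ^ 2 / 8 * ∫ x in Ici 0, |F2 x| := fun N =>
    (hmain N).trans (mul_le_mul_of_nonneg_left (hint N hF2.abs fun x _ => abs_nonneg _)
      (by positivity))
  -- Nonnegativity turns the finite error bound into a bound on partial sums. Summability then also
  -- forces the end term `F (N * δ)` to `0`.
  have hsum : Summable (fun k : ℕ => F (k * δ)) := by
    refine summable_of_sum_range_le
      (c := ((∫ x in Ici 0, F x) + δ / 2 * F 0 + δ ^ 2 / 8 * ∫ x in Ici 0, |F2 x|) / δ)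
      (fun k => hF0 _ (by positivity)) fun N => ?_
    rw [le_div_iff₀ hδ]
    have h1 := (abs_le.1 (hmain' N)).1
    have h2 := hint N hFint hF0
    have h3 : 0 ≤ δ / 2 * F (N * δ) := mul_nonneg (by positivity) (hF0 _ (by positivity))
    linarith
  refine ⟨hsum, ?_⟩
  have hN : Tendsto (fun N : ℕ => (N : ℝ) * δ) atTop atTop :=
    tendsto_natCast_atTop_atTop.atTop_mul_const hδ
  have t1 : Tendsto (fun N : ℕ => ∫ x in (0 : ℝ)..N * δ, F x) atTop (𝓝 (∫ x in Ici 0, F x)) := by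
    rw [integral_Ici_eq_integral_Ioi]
    exact intervalIntegral_tendsto_integral_Ioi 0 (hFint.mono_set Ioi_subset_Ici_self) hN
  have t := (((t1.sub (hsum.hasSum.tendsto_sum_nat.const_mul δ)).add_const (δ / 2 * F 0)).sub
    (hsum.tendsto_atTop_zero.const_mul (δ / 2))).abs
  rw [mul_zero, sub_zero] at t
  exact le_of_tendsto t (Eventually.of_forall hmain')

/-! ### Riemann sums and regularity of the Laplace transform. -/

/-- Data of a twice differentiable non-negative profile with exponential integrability of `f`,
`f'`, `f''` at rate `r`. -/
structure ExpIntegrable (f f1 f2 : ℝ → ℝ) (r : ℝ) : Prop where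
  nonneg : ∀ x, 0 ≤ x → 0 ≤ f x
  cont : ContinuousOn f (Ici 0)
  cont1 : ContinuousOn f1 (Ici 0)
  cont2 : ContinuousOn f2 (Ici 0)
  deriv : ∀ x, 0 < x → HasDerivAt f (f1 x) x
  deriv1 : ∀ x, 0 < x → HasDerivAt f1 (f2 x) x
  int : IntegrableOn (fun x => Real.exp (-r * x) * f x) (Ici 0)
  int1 : IntegrableOn (fun x => Real.exp (-r * x) * f1 x) (Ici 0)
  int2 : IntegrableOn (fun x => Real.exp (-r * x) * f2 x) (Ici 0)

/-- The factor `1 + e^z` covers both signs of `z`: after multiplication by `e^{-αx}` with `z = -(β -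
α)x` it becomes `e^{-αx} + e^{-βx}`. -/
theorem exp_sub_one_sub_le (z : ℝ) : Real.exp z - 1 - z ≤ z ^ 2 * (1 + Real.exp z) := by
  have h1 : Real.exp z * (1 - z) ≤ 1 := by
    have := Real.add_one_le_exp (-z)
    have h2 : Real.exp z * Real.exp (-z) = 1 := by rw [← Real.exp_add]; simp
    nlinarith [Real.exp_pos z]
  have h3 := Real.add_one_le_exp z
  have h4 := Real.exp_pos z
  have h5 : z * (Real.exp z - 1) ≤ z ^ 2 * (1 + Real.exp z) := by
    rcases le_total 0 z with h | h <;> nlinarith [sq_nonneg z, mul_nonneg (sq_nonneg z) h4.le]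
  nlinarith

/-- The derivative of the Laplace transform, `-∫ x e^{-γ x} f(x) dx`. -/
noncomputable def laplaceDeriv (f : ℝ → ℝ) (γ : ℝ) : ℝ :=
  -∫ x in Ici (0 : ℝ), Real.exp (-γ * x) * (x * f x)

namespace ExpIntegrable

variable {f f1 f2 : ℝ → ℝ} {r : ℝ}

theorem integrable_of_abs_le {G : ℝ → ℝ} {φ : ℝ → ℝ} (hφ : IntegrableOn φ (Ici 0))
    (hG : ContinuousOn G (Ici 0)) {K : ℝ} (h : ∀ x, 0 ≤ x → |G x| ≤ K * |φ x|) :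
    IntegrableOn G (Ici 0) ∧ ∫ x in Ici 0, |G x| ≤ K * ∫ x in Ici 0, |φ x| := by
  have h1 : ∀ᵐ x ∂(volume.restrict (Ici (0 : ℝ))), ‖G x‖ ≤ K * |φ x| :=
    (ae_restrict_iff' measurableSet_Ici).2 (Eventually.of_forall h)
  have h2 : IntegrableOn G (Ici 0) := by
    have hm : AEStronglyMeasurable G (volume.restrict (Ici (0 : ℝ))) :=
      hG.aestronglyMeasurable measurableSet_Ici
    exact Integrable.mono' (hφ.abs.const_mul K) hm h1
  refine ⟨h2, ?_⟩
  rw [← integral_const_mul]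
  exact integral_mono_ae h2.abs (hφ.abs.const_mul K) h1

theorem exp_le {r β x : ℝ} (hβ : r ≤ β) (hx : 0 ≤ x) : Real.exp (-β * x) ≤ Real.exp (-r * x) :=
  Real.exp_le_exp.2 (by nlinarith)

/-- The trapezoidal rule for `e^{-βx} f(x)`. Its second derivative `e^{-βx}(f'' - 2βf' + β²f)` is
dominated by `(1 + |β|)²` times a function free of `β`, so one `K` serves all `β ≥ r`. -/
theorem exists_sum_bound (h : ExpIntegrable f f1 f2 r) :
    ∃ K : ℝ, ∀ β, r ≤ β → ∀ δ : ℝ, 0 < δ →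
      Summable (fun k : ℕ => Real.exp (-β * (k * δ)) * f (k * δ)) ∧
      |δ * (∑' k : ℕ, Real.exp (-β * (k * δ)) * f (k * δ)) - laplace f β - δ / 2 * f 0| ≤
        K * (1 + |β|) ^ 2 * δ ^ 2 := by
  have hφ : IntegrableOn (fun x => |Real.exp (-r * x) * f x| + |Real.exp (-r * x) * f1 x| +
      |Real.exp (-r * x) * f2 x|) (Ici 0) := (h.int.abs.add h.int1.abs).add h.int2.abs
  refine ⟨1 / 8 * ∫ x in Ici 0, |(|Real.exp (-r * x) * f x| + |Real.exp (-r * x) * f1 x| +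
      |Real.exp (-r * x) * f2 x|)|, fun β hβ δ hδ => ?_⟩
  have he : ∀ x, HasDerivAt (fun x => Real.exp (-β * x)) (Real.exp (-β * x) * (-β * 1)) x :=
    fun x => ((hasDerivAt_id x).const_mul (-β)).exp
  have hec : ContinuousOn (fun x => Real.exp (-β * x)) (Ici 0) := by fun_prop
  have hF : ContinuousOn (fun x => Real.exp (-β * x) * f x) (Ici 0) := hec.mul h.cont
  have hF1 : ContinuousOn (fun x => Real.exp (-β * x) * (f1 x - β * f x)) (Ici 0) :=
    hec.mul (h.cont1.sub (continuousOn_const.mul h.cont))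
  have hF2 : ContinuousOn (fun x => Real.exp (-β * x) * (f2 x - 2 * β * f1 x + β ^ 2 * f x))
      (Ici 0) :=
    hec.mul ((h.cont2.sub (continuousOn_const.mul h.cont1)).add (continuousOn_const.mul h.cont))
  have hd : ∀ x, 0 < x → HasDerivAt (fun x => Real.exp (-β * x) * f x)
      (Real.exp (-β * x) * (f1 x - β * f x)) x := fun x hx =>
    ((he x).mul (h.deriv x hx)).congr_deriv (by ring)
  have hd1 : ∀ x, 0 < x → HasDerivAt (fun x => Real.exp (-β * x) * (f1 x - β * f x))
      (Real.exp (-β * x) * (f2 x - 2 * β * f1 x + β ^ 2 * f x)) x := fun x hx =>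
    ((he x).mul ((h.deriv1 x hx).sub ((h.deriv x hx).const_mul β))).congr_deriv (by
      simp only [Pi.sub_apply]
      ring)
  have hFi := (integrable_of_abs_le h.int hF (K := 1) fun x hx => by
    rw [abs_mul, abs_mul, Real.abs_exp, Real.abs_exp, one_mul]
    exact mul_le_mul_of_nonneg_right (exp_le hβ hx) (abs_nonneg _)).1
  obtain ⟨hF2i, hF2b⟩ := integrable_of_abs_le hφ hF2 (K := (1 + |β|) ^ 2) fun x hx => by
    have h0 : ∀ a b c : ℝ, |a - 2 * β * b + β ^ 2 * c| ≤ (1 + |β|) ^ 2 * (|c| + |b| + |a|) := by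
      intro a b c
      have h1 : |a - 2 * β * b + β ^ 2 * c| ≤ |a| + 2 * |β| * |b| + |β| ^ 2 * |c| := by
        refine (abs_add_le _ _).trans ?_
        refine (add_le_add_left (abs_sub _ _) _).trans (le_of_eq ?_)
        rw [abs_mul, abs_mul, abs_mul, abs_pow, abs_two]
      have h2 : 0 ≤ |β| * |a| := by positivity
      have h3 : 0 ≤ |β| ^ 2 * |a| := by positivity
      have h4 : 0 ≤ |β| ^ 2 * |b| := by positivity
      have h5 : 0 ≤ |β| * |c| := by positivity
      nlinarith [abs_nonneg a, abs_nonneg b, abs_nonneg c]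
    rw [abs_mul, Real.abs_exp, abs_of_nonneg (a := |Real.exp (-r * x) * f x| +
      |Real.exp (-r * x) * f1 x| + |Real.exp (-r * x) * f2 x|) (by positivity)]
    simp only [abs_mul, Real.abs_exp]
    calc _ ≤ Real.exp (-r * x) * ((1 + |β|) ^ 2 * (|f x| + |f1 x| + |f2 x|)) :=
          mul_le_mul (exp_le hβ hx) (h0 _ _ _) (abs_nonneg _) (Real.exp_pos _).le
      _ = _ := by ring
  obtain ⟨hs, hb⟩ := summable_and_abs_integral_sub_tsum_le hF hF1 hd hd1 hFi hF2i
    (fun x hx => mul_nonneg (Real.exp_pos _).le (h.nonneg x hx)) hδ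
  refine ⟨hs, ?_⟩
  have e1 : δ * (∑' k : ℕ, Real.exp (-β * (k * δ)) * f (k * δ)) - laplace f β - δ / 2 * f 0 =
      -((∫ x in Ici 0, Real.exp (-β * x) * f x) -
        δ * (∑' k : ℕ, Real.exp (-β * (k * δ)) * f (k * δ)) +
        δ / 2 * (Real.exp (-β * 0) * f 0)) := by
    simp only [laplace, mul_zero, Real.exp_zero]; ring
  rw [e1, abs_neg]
  refine hb.trans ?_
  refine (mul_le_mul_of_nonneg_left hF2b (by positivity)).trans (le_of_eq ?_)
  ring

theorem integrable_laplace (h : ExpIntegrable f f1 f2 r) {β : ℝ} (hβ : r ≤ β) :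
    IntegrableOn (fun x => Real.exp (-β * x) * f x) (Ici 0) ∧
      ∫ x in Ici 0, |Real.exp (-β * x) * f x| ≤ 1 * ∫ x in Ici 0, |Real.exp (-r * x) * f x| :=
  integrable_of_abs_le (G := fun x => Real.exp (-β * x) * f x) h.int
      (ContinuousOn.mul (by fun_prop) h.cont) fun x hx => by
    rw [abs_mul, abs_mul, Real.abs_exp, Real.abs_exp, one_mul]
    exact mul_le_mul_of_nonneg_right (exp_le hβ hx) (abs_nonneg _)

/-- The gap `r₀ - r` pays for the power: `(εx)^n / n! ≤ e^{εx}` with `ε = r₀ - r`. -/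
theorem pow_mul_exp_le {r₀ β x : ℝ} (hr : r < r₀) (hβ : r₀ ≤ β) (hx : 0 ≤ x) (n : ℕ) :
    Real.exp (-β * x) * x ^ n ≤ n.factorial / (r₀ - r) ^ n * Real.exp (-r * x) := by
  have hε : 0 < r₀ - r := sub_pos.2 hr
  have h1 := Real.pow_div_factorial_le_exp ((r₀ - r) * x) (by positivity) n
  have h2 : x ^ n ≤ n.factorial / (r₀ - r) ^ n * Real.exp ((r₀ - r) * x) := by
    rw [div_le_iff₀ (by positivity), mul_pow] at h1
    rw [div_mul_eq_mul_div, le_div_iff₀ (by positivity)]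
    linarith
  calc _ ≤ Real.exp (-r₀ * x) * (n.factorial / (r₀ - r) ^ n * Real.exp ((r₀ - r) * x)) :=
        mul_le_mul (exp_le hβ hx) h2 (by positivity) (Real.exp_pos _).le
    _ = n.factorial / (r₀ - r) ^ n * (Real.exp (-r₀ * x) * Real.exp ((r₀ - r) * x)) := by ring
    _ = _ := by rw [← Real.exp_add]; congr 2; ring

theorem integrable_pow (h : ExpIntegrable f f1 f2 r) {r₀ β : ℝ} (hr : r < r₀) (hβ : r₀ ≤ β)
    (n : ℕ) :
    IntegrableOn (fun x => Real.exp (-β * x) * (x ^ n * f x)) (Ici 0) ∧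
      ∫ x in Ici 0, |Real.exp (-β * x) * (x ^ n * f x)| ≤
        n.factorial / (r₀ - r) ^ n * ∫ x in Ici 0, |Real.exp (-r * x) * f x| :=
  integrable_of_abs_le (G := fun x => Real.exp (-β * x) * (x ^ n * f x)) h.int
    (ContinuousOn.mul (by fun_prop) (ContinuousOn.mul (by fun_prop) h.cont)) fun x hx => by
    rw [← mul_assoc, abs_mul (_ * _), abs_mul (Real.exp (-r * x)), ← mul_assoc, Real.abs_exp,
      abs_of_nonneg (a := Real.exp (-β * x) * x ^ n) (by positivity)]
    exact mul_le_mul_of_nonneg_right (pow_mul_exp_le hr hβ hx n) (abs_nonneg _)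

/-- The remainder is the integral of `e^{-αx}(e^z - 1 - z) f(x)` with `z = -(β - α)x`, to which
`exp_sub_one_sub_le` applies pointwise. -/
theorem exists_taylor_bound (h : ExpIntegrable f f1 f2 r) {r₀ : ℝ} (hr : r < r₀) :
    ∃ K : ℝ, ∀ α β, r₀ ≤ α → r₀ ≤ β →
      |laplace f β - laplace f α - (β - α) * laplaceDeriv f α| ≤ K * (β - α) ^ 2 := by
  refine ⟨2 * ∫ x in Ici 0, |Real.exp (-r₀ * x) * (x ^ 2 * f x)|, fun α β hα hβ => ?_⟩
  have iα := (h.integrable_laplace (hr.le.trans hα)).1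
  have iβ := (h.integrable_laplace (hr.le.trans hβ)).1
  have i1 := (h.integrable_pow hr hα 1).1
  simp only [pow_one] at i1
  have i2 := (h.integrable_pow hr le_rfl 2).1
  have e : laplace f β - laplace f α - (β - α) * laplaceDeriv f α =
      ∫ x in Ici 0, (Real.exp (-β * x) * f x - Real.exp (-α * x) * f x +
        (β - α) * (Real.exp (-α * x) * (x * f x))) := by
    rw [integral_add (f := fun x => Real.exp (-β * x) * f x - Real.exp (-α * x) * f x)
      (iβ.sub iα) (i1.const_mul _), integral_sub iβ iα, integral_const_mul]
    simp only [laplace, laplaceDeriv]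
    ring
  have hb : ∀ x, 0 ≤ x → |Real.exp (-β * x) * f x - Real.exp (-α * x) * f x +
        (β - α) * (Real.exp (-α * x) * (x * f x))| ≤
      (2 * (β - α) ^ 2) * |Real.exp (-r₀ * x) * (x ^ 2 * f x)| := by
    intro x hx
    have hz0 := Real.add_one_le_exp (-(β - α) * x)
    have hz1 := exp_sub_one_sub_le (-(β - α) * x)
    have hα' := exp_le hα hx
    have hβ' := exp_le hβ hx
    have e2 : Real.exp (-β * x) = Real.exp (-α * x) * Real.exp (-(β - α) * x) := by
      rw [← Real.exp_add]; congr 1; ring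
    have e3 : Real.exp (-β * x) * f x - Real.exp (-α * x) * f x +
        (β - α) * (Real.exp (-α * x) * (x * f x)) =
        Real.exp (-α * x) * (Real.exp (-(β - α) * x) - 1 - (-(β - α) * x)) * f x := by
      rw [e2]; ring
    have hp := Real.exp_pos (-α * x)
    have hf := h.nonneg x hx
    rw [e3, abs_of_nonneg (mul_nonneg (mul_nonneg hp.le (by linarith)) hf),
      abs_of_nonneg (by positivity)]
    have h4 : Real.exp (-α * x) * (Real.exp (-(β - α) * x) - 1 - (-(β - α) * x)) ≤
        2 * (β - α) ^ 2 * Real.exp (-r₀ * x) * x ^ 2 := by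
      calc _ ≤ Real.exp (-α * x) * ((-(β - α) * x) ^ 2 * (1 + Real.exp (-(β - α) * x))) :=
            mul_le_mul_of_nonneg_left hz1 hp.le
        _ = (β - α) ^ 2 * x ^ 2 * (Real.exp (-α * x) + Real.exp (-β * x)) := by rw [e2]; ring
        _ ≤ (β - α) ^ 2 * x ^ 2 * (Real.exp (-r₀ * x) + Real.exp (-r₀ * x)) :=
            mul_le_mul_of_nonneg_left (add_le_add hα' hβ') (by positivity)
        _ = _ := by ring
    calc _ ≤ _ := mul_le_mul_of_nonneg_right h4 hf
      _ = _ := by ring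
  have hcont : ContinuousOn (fun x => Real.exp (-β * x) * f x - Real.exp (-α * x) * f x +
        (β - α) * (Real.exp (-α * x) * (x * f x))) (Ici 0) := by
    have := h.cont
    fun_prop
  rw [e]
  refine (abs_integral_le_integral_abs).trans ((integrable_of_abs_le i2 hcont hb).2.trans
    (le_of_eq ?_))
  ring

theorem hasDerivAt_laplace (h : ExpIntegrable f f1 f2 r) {γ : ℝ} (hγ : r < γ) :
    HasDerivAt (laplace f) (laplaceDeriv f γ) γ := by
  obtain ⟨r₀, h1, h2⟩ := exists_between hγ
  obtain ⟨K, hK⟩ := h.exists_taylor_bound h1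
  rw [hasDerivAt_iff_isLittleO]
  have hO : (fun β => laplace f β - laplace f γ - (β - γ) • laplaceDeriv f γ) =O[𝓝 γ]
      fun β => (β - γ) ^ 2 := by
    refine IsBigO.of_bound K ?_
    filter_upwards [lt_mem_nhds h2] with β hβ
    rw [Real.norm_eq_abs, smul_eq_mul, Real.norm_of_nonneg (sq_nonneg _)]
    exact hK γ β h2.le hβ.le
  refine hO.trans_isLittleO ?_
  have h0 : Tendsto (fun β => β - γ) (𝓝 γ) (𝓝 0) := by
    have : Continuous fun β => β - γ := by fun_prop
    simpa using this.tendsto γ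
  have : (fun β => (β - γ) * (β - γ)) =o[𝓝 γ] fun β => 1 * (β - γ) :=
    ((isLittleO_one_iff ℝ).2 h0).mul_isBigO (isBigO_refl _ _)
  simpa [pow_two] using this

theorem abs_laplace_le (h : ExpIntegrable f f1 f2 r) {β : ℝ} (hβ : r ≤ β) :
    |laplace f β| ≤ ∫ x in Ici 0, |Real.exp (-r * x) * f x| := by
  refine abs_integral_le_integral_abs.trans ?_
  simpa using (h.integrable_laplace hβ).2

theorem abs_laplaceDeriv_le (h : ExpIntegrable f f1 f2 r) {r₀ β : ℝ} (hr : r < r₀) (hβ : r₀ ≤ β) :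
    |laplaceDeriv f β| ≤ 1 / (r₀ - r) * ∫ x in Ici 0, |Real.exp (-r * x) * f x| := by
  rw [laplaceDeriv, abs_neg]
  refine abs_integral_le_integral_abs.trans ?_
  simpa using (h.integrable_pow hr hβ 1).2

theorem laplace_nonneg (h : ExpIntegrable f f1 f2 r) (β : ℝ) : 0 ≤ laplace f β :=
  setIntegral_nonneg measurableSet_Ici fun x hx => mul_nonneg (Real.exp_pos _).le (h.nonneg x hx)

/-- At `γ = √s` the ratio is `0` and no rate `β` represents it, so the series is compared with the
one at rate `γ` through `1 - x ≤ e^{-x}`. -/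
theorem summable_waitSum (h : ExpIntegrable f f1 f2 r) {γ : ℝ} (hγ : r ≤ γ) {s : ℕ} (hs : 1 ≤ s)
    (hγs : γ ≤ √(s : ℝ)) :
    Summable fun k : ℕ => (1 - γ / √(s : ℝ)) ^ k * f (k / √(s : ℝ)) := by
  obtain ⟨K, hK⟩ := h.exists_sum_bound
  have hδ : 0 < (√(s : ℝ))⁻¹ := by positivity
  have hρ := load_nonneg hs hγs
  refine (hK γ hγ _ hδ).1.of_nonneg_of_le (fun k => ?_) fun k => ?_
  · exact mul_nonneg (pow_nonneg hρ k) (h.nonneg _ (by positivity))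
  · rw [div_eq_mul_inv (k : ℝ)]
    refine mul_le_mul_of_nonneg_right ?_ (h.nonneg _ (by positivity))
    have h1 : 1 - γ / √(s : ℝ) ≤ Real.exp (-γ * (√(s : ℝ))⁻¹) := by
      have := Real.add_one_le_exp (-γ * (√(s : ℝ))⁻¹)
      rw [div_eq_mul_inv]
      linarith
    refine (pow_le_pow_left₀ hρ h1 k).trans (le_of_eq ?_)
    rw [← Real.exp_nat_mul]
    congr 1
    ring

end ExpIntegrable

/-! ### Expansion of the waiting sum, uniformly in `γ`. -/

/-- The filter of `s → ∞`, uniformly for `γ ∈ C`. -/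
def unifAtTop (C : Set ℝ) : Filter (ℕ × ℝ) := atTop ×ˢ 𝓟 C

/-- The expansion parameter `1 / √s`. -/
noncomputable def invSqrt (x : ℕ × ℝ) : ℝ := (√(x.1 : ℝ))⁻¹

theorem eventually_unifAtTop {C : Set ℝ} {P : ℕ × ℝ → Prop} :
    (∀ᶠ x in unifAtTop C, P x) ↔ ∃ s₀, ∀ s, s₀ ≤ s → ∀ γ ∈ C, P (s, γ) := by
  rw [unifAtTop, Filter.Eventually, mem_prod_principal]
  change (∀ᶠ s in atTop, ∀ γ ∈ C, P (s, γ)) ↔ _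
  rw [eventually_atTop]

theorem eventually_mem_unifAtTop (C : Set ℝ) : ∀ᶠ x in unifAtTop C, x.2 ∈ C :=
  eventually_unifAtTop.2 ⟨0, fun _ _ _ h => h⟩

theorem tendsto_invSqrt (C : Set ℝ) : Tendsto invSqrt (unifAtTop C) (𝓝 0) := by
  have h1 : Tendsto (fun x : ℕ × ℝ => x.1) (unifAtTop C) atTop := tendsto_fst
  have h2 : Tendsto (fun s : ℕ => (√(s : ℝ))⁻¹) atTop (𝓝 0) :=
    (Real.tendsto_sqrt_atTop.comp tendsto_natCast_atTop_atTop).inv_tendsto_atTop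
  exact h2.comp h1

theorem eventually_invSqrt_pos (C : Set ℝ) : ∀ᶠ x in unifAtTop C, 0 < invSqrt x := by
  refine eventually_unifAtTop.2 ⟨1, fun s hs γ _ => ?_⟩
  have : (0 : ℝ) < s := by exact_mod_cast hs
  unfold invSqrt
  positivity

theorem isBigO_one_of_bound {C : Set ℝ} {u : ℝ → ℝ} {K : ℝ} (h : ∀ γ ∈ C, |u γ| ≤ K) :
    (fun x : ℕ × ℝ => u x.2) =O[unifAtTop C] (fun _ => (1 : ℝ)) := by
  refine IsBigO.of_bound K ?_
  filter_upwards [eventually_mem_unifAtTop C] with x hx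
  simpa using h _ hx

/-- The rate `β ≥ γ` with `exp (-β δ) = 1 - γ δ`. -/
theorem exists_rate {γ δ G : ℝ} (hG : |γ| ≤ G) (hδ : 0 < δ) (h : G * δ ≤ 1 / 2) :
    ∃ β, Real.exp (-β * δ) = 1 - γ * δ ∧ γ ≤ β ∧
      |β - γ - γ ^ 2 / 2 * δ| ≤ 2 * G ^ 3 * δ ^ 2 := by
  have hx : |γ * δ| ≤ G * δ := by
    rw [abs_mul, abs_of_pos hδ]; exact mul_le_mul_of_nonneg_right hG hδ.le
  have hlt : γ * δ < 1 := by linarith [(abs_le.1 (hx.trans h)).2]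
  refine ⟨-Real.log (1 - γ * δ) / δ, ?_, ?_, ?_⟩
  · have : -(-Real.log (1 - γ * δ) / δ) * δ = Real.log (1 - γ * δ) := by field_simp
    rw [this, Real.exp_log (by linarith)]
  · rw [le_div_iff₀ hδ]
    have := Real.log_le_sub_one_of_pos (show 0 < 1 - γ * δ by linarith)
    linarith
  · have h1 := Real.abs_log_sub_add_sum_range_le (show |γ * δ| < 1 by linarith) 2
    rw [Finset.sum_range_succ, Finset.sum_range_one] at h1
    have h2 : |γ * δ| ^ (2 + 1) / (1 - |γ * δ|) ≤ 2 * G ^ 3 * δ ^ 3 := by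
      rw [div_le_iff₀ (by linarith)]
      have h3 : |γ * δ| ^ 3 ≤ (G * δ) ^ 3 := pow_le_pow_left₀ (abs_nonneg _) hx 3
      have h4 : 0 ≤ (G * δ) ^ 3 := (pow_nonneg (abs_nonneg _) 3).trans h3
      have h5 : (1 : ℝ) / 2 ≤ 1 - |γ * δ| := by linarith
      have h6 := mul_le_mul_of_nonneg_left h5 h4
      simp only [Nat.reduceAdd]
      nlinarith
    have e : -Real.log (1 - γ * δ) / δ - γ - γ ^ 2 / 2 * δ =
        -((γ * δ) ^ (0 + 1) / ((0 : ℕ) + 1) + (γ * δ) ^ (1 + 1) / ((1 : ℕ) + 1) +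
          Real.log (1 - γ * δ)) / δ := by
      push_cast
      field_simp
      ring
    rw [e, abs_div, abs_neg, abs_of_pos hδ, div_le_iff₀ hδ]
    refine (h1.trans h2).trans (le_of_eq ?_)
    ring

theorem ExpIntegrable.hasExpansion_waitSum {f f1 f2 : ℝ → ℝ} {r r₀ : ℝ}
    (h : ExpIntegrable f f1 f2 r) (hf0 : f 0 = 1) (hr : r < r₀) {C : Set ℝ} {G : ℝ}
    (hC : ∀ γ ∈ C, r₀ ≤ γ ∧ |γ| ≤ G) :
    HasExpansion (unifAtTop C) invSqrt (fun x => invSqrt x * waitSum f x.1 x.2)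
      (fun x => laplace f x.2) (fun x => 1 / 2 * x.2 ^ 2 * laplaceDeriv f x.2 + 1 / 2) := by
  obtain ⟨K1, hK1⟩ := h.exists_sum_bound
  obtain ⟨K2, hK2⟩ := h.exists_taylor_bound hr
  have hL1 : (fun x : ℕ × ℝ => laplaceDeriv f x.2) =O[unifAtTop C] (fun _ => (1 : ℝ)) :=
    isBigO_one_of_bound fun γ hγ => h.abs_laplaceDeriv_le hr (hC γ hγ).1
  have hid : (fun x : ℕ × ℝ => x.2) =O[unifAtTop C] (fun _ => (1 : ℝ)) :=
    isBigO_one_of_bound (u := fun γ => γ) fun γ hγ => (hC γ hγ).2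
  refine ⟨isBigO_one_of_bound fun γ hγ => h.abs_laplace_le (hr.le.trans (hC γ hγ).1), ?_, ?_⟩
  · refine IsBigO.add ?_ (isBigO_const_const _ one_ne_zero _)
    have h2 : (fun x : ℕ × ℝ => 1 / 2 * x.2 ^ 2) =O[unifAtTop C] (fun _ => (1 : ℝ)) := by
      simpa using (hid.pow 2).const_mul_left (1 / 2)
    simpa using h2.mul hL1
  · have hsmall : ∀ᶠ x in unifAtTop C, |G| * invSqrt x < 1 / 2 := by
      have : Tendsto (fun x => |G| * invSqrt x) (unifAtTop C) (𝓝 (|G| * 0)) :=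
        (tendsto_invSqrt C).const_mul _
      rw [mul_zero] at this
      exact this.eventually (gt_mem_nhds (by norm_num))
    refine IsBigO.of_bound (|K1| * (1 + (|G| + |G| ^ 2 / 2 + 2 * |G| ^ 3)) ^ 2 +
      |K2| * (|G| ^ 2 / 2 + 2 * |G| ^ 3) ^ 2 +
      2 * |G| ^ 3 * (1 / (r₀ - r) * ∫ x in Ici 0, |Real.exp (-r * x) * f x|)) ?_
    have hle1 : ∀ᶠ x in unifAtTop C, invSqrt x < 1 :=
      (tendsto_invSqrt C).eventually (gt_mem_nhds one_pos)
    filter_upwards [eventually_mem_unifAtTop C, eventually_invSqrt_pos C, hsmall, hle1]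
      with x hx hδ hsm hδ1
    obtain ⟨hγ, hG⟩ := hC _ hx
    set δ := invSqrt x with hδdef
    set γ := x.2
    obtain ⟨β, hβ1, hβ2, hβ3⟩ := exists_rate (hG.trans (le_abs_self G)) hδ hsm.le
    have hws : waitSum f x.1 γ = ∑' k : ℕ, Real.exp (-β * (k * δ)) * f (k * δ) := by
      refine tsum_congr fun k => ?_
      rw [div_eq_mul_inv, div_eq_mul_inv]
      change (1 - γ * δ) ^ k * f (k * δ) = _
      rw [← hβ1, ← Real.exp_nat_mul]
      congr 2
      ring
    have b1 := (hK1 β (hr.le.trans (hγ.trans hβ2)) δ hδ).2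
    rw [hf0, mul_one, ← hws] at b1
    have b2 := hK2 γ β hγ (hγ.trans hβ2)
    have b3 := h.abs_laplaceDeriv_le hr hγ
    have hGa : |γ| ≤ |G| := hG.trans (le_abs_self G)
    have d1 : |β - γ| ≤ (|G| ^ 2 / 2 + 2 * |G| ^ 3) * δ := by
      have : β - γ = (β - γ - γ ^ 2 / 2 * δ) + γ ^ 2 / 2 * δ := by ring
      rw [this]
      refine (abs_add_le _ _).trans ?_
      have h1 : |γ ^ 2 / 2 * δ| ≤ |G| ^ 2 / 2 * δ := by
        rw [abs_mul, abs_of_pos hδ, abs_div, abs_two, abs_pow]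
        gcongr
      have h2 : 2 * |G| ^ 3 * δ ^ 2 ≤ 2 * |G| ^ 3 * δ := by
        refine mul_le_mul_of_nonneg_left ?_ (by positivity)
        nlinarith
      nlinarith
    have d2 : |β| ≤ |G| + |G| ^ 2 / 2 + 2 * |G| ^ 3 := by
      have : β = γ + (β - γ) := by ring
      rw [this]
      refine (abs_add_le _ _).trans ?_
      have : (|G| ^ 2 / 2 + 2 * |G| ^ 3) * δ ≤ (|G| ^ 2 / 2 + 2 * |G| ^ 3) * 1 :=
        mul_le_mul_of_nonneg_left hδ1.le (by positivity)
      linarith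
    have c1 : K1 * (1 + |β|) ^ 2 * δ ^ 2 ≤
        |K1| * (1 + (|G| + |G| ^ 2 / 2 + 2 * |G| ^ 3)) ^ 2 * δ ^ 2 := by
      gcongr
      exact le_abs_self _
    have c2 : K2 * (β - γ) ^ 2 ≤ |K2| * (|G| ^ 2 / 2 + 2 * |G| ^ 3) ^ 2 * δ ^ 2 := by
      have : (β - γ) ^ 2 ≤ ((|G| ^ 2 / 2 + 2 * |G| ^ 3) * δ) ^ 2 := by
        rw [← sq_abs]
        exact pow_le_pow_left₀ (abs_nonneg _) d1 2
      calc _ ≤ |K2| * ((|G| ^ 2 / 2 + 2 * |G| ^ 3) * δ) ^ 2 :=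
            mul_le_mul (le_abs_self _) this (sq_nonneg _) (abs_nonneg _)
        _ = _ := by ring
    have c3 : |(β - γ - γ ^ 2 / 2 * δ) * laplaceDeriv f γ| ≤
        2 * |G| ^ 3 * δ ^ 2 * (1 / (r₀ - r) * ∫ x in Ici 0, |Real.exp (-r * x) * f x|) := by
      rw [abs_mul]
      exact mul_le_mul hβ3 b3 (abs_nonneg _) (by positivity)
    -- Three errors: quadrature at rate `β`, Taylor expansion of the transform from `γ` to `β`, and
    -- the expansion of `β` itself.
    have e : δ * waitSum f x.1 γ - laplace f γ - (1 / 2 * γ ^ 2 * laplaceDeriv f γ + 1 / 2) * δ =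
        (δ * waitSum f x.1 γ - laplace f β - δ / 2) +
        (laplace f β - laplace f γ - (β - γ) * laplaceDeriv f γ) +
        (β - γ - γ ^ 2 / 2 * δ) * laplaceDeriv f γ := by ring
    rw [Real.norm_eq_abs, Real.norm_of_nonneg (sq_nonneg _), e]
    refine (abs_add_three _ _ _).trans ?_
    refine (add_le_add (add_le_add (b1.trans c1) (b2.trans c2)) c3).trans (le_of_eq ?_)
    ring


/-! ### Erlang B as an integral, and bounds for the logarithm. -/

theorem integrableOn_pow_mul_exp_neg {a : ℝ} (ha : 0 < a) (n : ℕ) :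
    IntegrableOn (fun u : ℝ => u ^ n * Real.exp (-(a * u))) (Ioi 0) := by
  have h := integrableOn_rpow_mul_exp_neg_mul_rpow (p := 1) (s := n) (b := a)
    (by have : (0 : ℝ) ≤ n := n.cast_nonneg
        linarith) one_pos ha
  simpa only [Real.rpow_natCast, Real.rpow_one, neg_mul] using h

theorem integral_pow_mul_exp_neg {a : ℝ} (ha : 0 < a) (n : ℕ) :
    ∫ u in Ioi (0 : ℝ), u ^ n * Real.exp (-(a * u)) = n.factorial / a ^ (n + 1) := by
  have h := Real.integral_rpow_mul_exp_neg_mul_Ioi (a := (n : ℝ) + 1) (r := a)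
    (by positivity) ha
  rw [Real.Gamma_nat_eq_factorial, add_sub_cancel_right] at h
  simp only [Real.rpow_natCast] at h
  rw [h]
  have : ((n : ℝ) + 1) = ((n + 1 : ℕ) : ℝ) := by push_cast; rfl
  rw [this, Real.rpow_natCast]
  rw [one_div, inv_pow]
  ring

/-- The integral representation of the reciprocal of the Erlang B probability. -/
theorem erlangInv_eq_integral (s : ℕ) {a δ : ℝ} (ha : 0 < a) (hδ : 0 < δ) :
    erlangInv s (a / δ) = a * ∫ u in Ioi (0 : ℝ), Real.exp (-(a * u)) * (1 + δ * u) ^ s := by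
  have h1 : ∀ u : ℝ, Real.exp (-(a * u)) * (1 + δ * u) ^ s =
      ∑ m ∈ Finset.range (s + 1), (s.choose m * δ ^ m) * (u ^ m * Real.exp (-(a * u))) := by
    intro u
    rw [add_comm, add_pow, Finset.mul_sum]
    refine Finset.sum_congr rfl fun m _ => ?_
    rw [mul_pow, one_pow]
    ring
  simp_rw [h1]
  rw [integral_finsetSum _ fun m _ => (integrableOn_pow_mul_exp_neg ha m).const_mul _]
  simp_rw [integral_const_mul, integral_pow_mul_exp_neg ha]
  -- The `m`-th binomial term integrates to the Erlang term with index `s - m`, hence the reversal.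
  rw [erlangInv, ← Finset.sum_flip, Finset.mul_sum]
  refine Finset.sum_congr rfl fun m hm => ?_
  have hm' : m ≤ s := Nat.lt_succ_iff.1 (Finset.mem_range.1 hm)
  rw [Nat.cast_choose ℝ hm']
  have h2 : (a / δ) ^ s = (a / δ) ^ (s - m) * (a / δ) ^ m := by
    rw [← pow_add, Nat.sub_add_cancel hm']
  rw [h2]
  have : ((s - m).factorial : ℝ) ≠ 0 := by positivity
  have : (m.factorial : ℝ) ≠ 0 := by positivity
  rw [div_pow _ _ m]
  field_simp
  ring

theorem nonneg_of_hasDerivAt_nonneg {g g' : ℝ → ℝ} (h0 : g 0 = 0)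
    (hd : ∀ v, 0 ≤ v → HasDerivAt g (g' v) v) (hg : ∀ v, 0 ≤ v → 0 ≤ g' v) {v : ℝ} (hv : 0 ≤ v) :
    0 ≤ g v := by
  have h1 : MonotoneOn g (Ici 0) := by
    refine monotoneOn_of_hasDerivWithinAt_nonneg (f' := g') (convex_Ici 0)
      (fun x hx => (hd x hx).continuousAt.continuousWithinAt) (fun x hx => ?_) (fun x hx => ?_)
    · exact (hd x (interior_subset hx)).hasDerivWithinAt
    · exact hg x (interior_subset hx)
  have := h1 self_mem_Ici hv hv
  rwa [h0] at this

theorem hasDerivAt_log_one_add {v : ℝ} (hv : 0 ≤ v) :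
    HasDerivAt (fun v : ℝ => Real.log (1 + v)) (1 / (1 + v)) v :=
  ((hasDerivAt_id v).const_add 1).log (by simp only [id]; linarith)

/-- The three differences vanish at `0` and have derivatives `v²/(1+v)`, `v³/(1+v)` and `v⁴/(1+v)`.
-/
theorem log_one_add_bounds {v : ℝ} (hv : 0 ≤ v) :
    0 ≤ Real.log (1 + v) - v + v ^ 2 / 2 ∧
      Real.log (1 + v) - v + v ^ 2 / 2 ≤ v ^ 3 / 3 ∧
      v ^ 3 / 3 - v ^ 4 / 4 ≤ Real.log (1 + v) - v + v ^ 2 / 2 := by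
  have p2 : ∀ v : ℝ, HasDerivAt (fun v : ℝ => v ^ 2 / 2) v v := fun v =>
    ((hasDerivAt_pow 2 v).div_const 2).congr_deriv (by norm_num)
  have p3 : ∀ v : ℝ, HasDerivAt (fun v : ℝ => v ^ 3 / 3) (v ^ 2) v := fun v =>
    ((hasDerivAt_pow 3 v).div_const 3).congr_deriv (by norm_num)
  have p4 : ∀ v : ℝ, HasDerivAt (fun v : ℝ => v ^ 4 / 4) (v ^ 3) v := fun v =>
    ((hasDerivAt_pow 4 v).div_const 4).congr_deriv (by norm_num)
  have l1 : ∀ v : ℝ, 0 ≤ v → HasDerivAt (fun v => Real.log (1 + v) - v + v ^ 2 / 2)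
      (1 / (1 + v) - 1 + v) v := fun v hv =>
    ((hasDerivAt_log_one_add hv).sub (hasDerivAt_id v)).add (p2 v)
  refine ⟨?_, ?_, ?_⟩
  · refine nonneg_of_hasDerivAt_nonneg (g := fun v => Real.log (1 + v) - v + v ^ 2 / 2)
      (by simp) l1 (fun v hv => ?_) hv
    have : 1 / (1 + v) - 1 + v = v ^ 2 / (1 + v) := by
      have : 1 + v ≠ 0 := by positivity
      field_simp; ring
    rw [this]; positivity
  · rw [← sub_nonneg]
    refine nonneg_of_hasDerivAt_nonneg
      (g := fun v => v ^ 3 / 3 - (Real.log (1 + v) - v + v ^ 2 / 2))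
      (by simp) (fun v hv => (p3 v).sub (l1 v hv)) (fun v hv => ?_) hv
    have : v ^ 2 - (1 / (1 + v) - 1 + v) = v ^ 3 / (1 + v) := by
      have : 1 + v ≠ 0 := by positivity
      field_simp; ring
    rw [this]; positivity
  · rw [← sub_nonneg]
    refine nonneg_of_hasDerivAt_nonneg
      (g := fun v => (Real.log (1 + v) - v + v ^ 2 / 2) - (v ^ 3 / 3 - v ^ 4 / 4))
      (by simp) (fun v hv => (l1 v hv).sub ((p3 v).sub (p4 v))) (fun v hv => ?_) hv
    have : (1 / (1 + v) - 1 + v) - (v ^ 2 - v ^ 3) = v ^ 4 / (1 + v) := by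
      have : 1 + v ≠ 0 := by positivity
      field_simp; ring
    rw [this]; positivity

/-- This is `w ≤ sinh w` at `w = log (1 + v)`. Unlike a Taylor bound it stays useful for large `v`,
where it supplies the decay of the Erlang integrand. -/
theorem log_one_add_le {v : ℝ} (hv : 0 ≤ v) :
    Real.log (1 + v) ≤ v - v ^ 2 / (2 * (1 + v)) := by
  have h1 : (0 : ℝ) < 1 + v := by positivity
  have h2 := Real.self_le_sinh_iff.2 (Real.log_nonneg (show 1 ≤ 1 + v by linarith))
  rw [Real.sinh_log h1] at h2
  refine h2.trans (le_of_eq ?_)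
  field_simp
  ring

/-! ### Half-line Gaussian moments, `g` and `h`. -/

/-- `∫₀^∞ uⁿ exp (γ u - u² / 2) du`. -/
noncomputable def gaussMoment (n : ℕ) (γ : ℝ) : ℝ :=
  ∫ u in Ioi (0 : ℝ), u ^ n * Real.exp (γ * u - u ^ 2 / 2)

theorem exp_gauss_le {γ G u : ℝ} (hγ : |γ| ≤ G) (hu : 0 ≤ u) :
    Real.exp (γ * u - u ^ 2 / 2) ≤ Real.exp ((G + 2) ^ 2 / 2) * Real.exp (-u) := by
  rw [← Real.exp_add]
  refine Real.exp_le_exp.2 ?_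
  have h1 : γ * u ≤ G * u := mul_le_mul_of_nonneg_right ((le_abs_self γ).trans hγ) hu
  have h2 : 0 ≤ G := (abs_nonneg γ).trans hγ
  nlinarith [sq_nonneg (u - (G + 1))]

theorem integrableOn_gaussMoment (n : ℕ) (γ : ℝ) :
    IntegrableOn (fun u : ℝ => u ^ n * Real.exp (γ * u - u ^ 2 / 2)) (Ioi 0) := by
  have h := (integrableOn_pow_mul_exp_neg one_pos n).const_mul (Real.exp ((|γ| + 2) ^ 2 / 2))
  refine h.mono' (Continuous.aestronglyMeasurable (by fun_prop)) ?_
  refine (ae_restrict_iff' measurableSet_Ioi).2 (Eventually.of_forall fun u hu => ?_)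
  have hu' : 0 ≤ u := le_of_lt hu
  rw [Real.norm_of_nonneg (by positivity), one_mul]
  calc _ ≤ u ^ n * (Real.exp ((|γ| + 2) ^ 2 / 2) * Real.exp (-u)) :=
        mul_le_mul_of_nonneg_left (exp_gauss_le le_rfl hu') (by positivity)
    _ = _ := by ring

theorem gaussMoment_nonneg (n : ℕ) (γ : ℝ) : 0 ≤ gaussMoment n γ :=
  setIntegral_nonneg measurableSet_Ioi fun u hu => by
    have hu' : 0 ≤ u := le_of_lt hu
    positivity

theorem gaussMoment_le {γ G : ℝ} (n : ℕ) (hγ : |γ| ≤ G) :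
    gaussMoment n γ ≤ Real.exp ((G + 2) ^ 2 / 2) * n.factorial := by
  have h := setIntegral_mono_on (integrableOn_gaussMoment n γ)
    ((integrableOn_pow_mul_exp_neg one_pos n).const_mul (Real.exp ((G + 2) ^ 2 / 2)))
    measurableSet_Ioi fun u hu => by
      have hu' : 0 ≤ u := le_of_lt hu
      rw [one_mul]
      calc _ ≤ u ^ n * (Real.exp ((G + 2) ^ 2 / 2) * Real.exp (-u)) :=
            mul_le_mul_of_nonneg_left (exp_gauss_le hγ hu') (by positivity)
        _ = Real.exp ((G + 2) ^ 2 / 2) * (u ^ n * Real.exp (-u)) := by ring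
  rw [integral_const_mul, integral_pow_mul_exp_neg one_pos, one_pow, div_one] at h
  exact h

theorem gaussMoment_zero_mono : Monotone (gaussMoment 0) := by
  intro α β h
  refine setIntegral_mono_on (integrableOn_gaussMoment 0 α) (integrableOn_gaussMoment 0 β)
    measurableSet_Ioi fun u hu => ?_
  have hu' : 0 ≤ u := le_of_lt hu
  have : α * u ≤ β * u := mul_le_mul_of_nonneg_right h hu'
  rw [pow_zero, one_mul, one_mul]
  exact Real.exp_le_exp.2 (by linarith)

theorem gaussMoment_zero_pos (γ : ℝ) : 0 < gaussMoment 0 γ := by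
  have h := integrableOn_gaussMoment 0 γ
  unfold gaussMoment
  simp only [pow_zero, one_mul] at h ⊢
  have : NeZero (volume.restrict (Ioi (0 : ℝ))) := ⟨by
    rw [Ne, Measure.restrict_eq_zero]; simp⟩
  exact integral_exp_pos h

/-- With `E = e^{γu - u²/2}`, the function `-(u² + γu + γ² + 2)E` is a primitive of `u³E - (γ³ +
3γ)E`; its value at `0` gives the constant. -/
theorem gaussMoment_three (γ : ℝ) :
    gaussMoment 3 γ = (γ ^ 3 + 3 * γ) * gaussMoment 0 γ + (γ ^ 2 + 2) := by
  have hd : ∀ u : ℝ, HasDerivAt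
      (fun u : ℝ => -(u ^ 2 + γ * u + (γ ^ 2 + 2)) * Real.exp (γ * u - u ^ 2 / 2))
      (u ^ 3 * Real.exp (γ * u - u ^ 2 / 2) -
        (γ ^ 3 + 3 * γ) * (u ^ 0 * Real.exp (γ * u - u ^ 2 / 2))) u := by
    intro u
    have h1 : HasDerivAt (fun u : ℝ => γ * u - u ^ 2 / 2) (γ * 1 - 2 * u / 2) u :=
      (((hasDerivAt_id u).const_mul γ).sub ((hasDerivAt_pow 2 u).div_const 2)).congr_deriv
        (by norm_num)
    have h2 : HasDerivAt (fun u : ℝ => -(u ^ 2 + γ * u + (γ ^ 2 + 2))) (-(2 * u + γ * 1)) u :=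
      ((((hasDerivAt_pow 2 u).add ((hasDerivAt_id u).const_mul γ))).add_const
        (γ ^ 2 + 2)).neg.congr_deriv (by norm_num)
    refine (h2.mul h1.exp).congr_deriv ?_
    ring
  have hlim : ∀ n : ℕ, Tendsto (fun u : ℝ => u ^ n * Real.exp (γ * u - u ^ 2 / 2)) atTop (𝓝 0) := by
    intro n
    have h1 := (Real.tendsto_pow_mul_exp_neg_atTop_nhds_zero n).const_mul
      (Real.exp ((|γ| + 2) ^ 2 / 2))
    rw [mul_zero] at h1
    refine tendsto_of_tendsto_of_tendsto_of_le_of_le' tendsto_const_nhds h1 ?_ ?_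
    · filter_upwards [eventually_ge_atTop 0] with u hu
      positivity
    · filter_upwards [eventually_ge_atTop 0] with u hu
      calc _ ≤ u ^ n * (Real.exp ((|γ| + 2) ^ 2 / 2) * Real.exp (-u)) :=
            mul_le_mul_of_nonneg_left (exp_gauss_le le_rfl hu) (by positivity)
        _ = _ := by ring
  have hlim' : Tendsto
      (fun u : ℝ => -(u ^ 2 + γ * u + (γ ^ 2 + 2)) * Real.exp (γ * u - u ^ 2 / 2)) atTop (𝓝 0) := by
    have h1 := (((hlim 2).add ((hlim 1).const_mul γ)).add ((hlim 0).const_mul (γ ^ 2 + 2))).neg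
    simp only [mul_zero, add_zero, neg_zero] at h1
    refine h1.congr fun u => ?_
    ring
  have i3 := integrableOn_gaussMoment 3 γ
  have i0 := (integrableOn_gaussMoment 0 γ).const_mul (γ ^ 3 + 3 * γ)
  have h := integral_Ioi_of_hasDerivAt_of_tendsto' (a := 0) (fun u _ => hd u) (i3.sub i0) hlim'
  rw [integral_sub i3 i0, integral_const_mul] at h
  change gaussMoment 3 γ - (γ ^ 3 + 3 * γ) * gaussMoment 0 γ = _ at h
  simp at h
  linear_combination h

/-- Substitute `x = γ - u` in `Φ(γ)` and use `φ(γ - u) = φ(γ) e^{γu - u²/2}`. -/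
theorem gFun_eq (γ : ℝ) : gFun γ = (gaussMoment 0 γ)⁻¹ := by
  have h1 : ProbabilityTheory.cdf (ProbabilityTheory.gaussianReal 0 1) γ =
      ProbabilityTheory.gaussianPDFReal 0 1 γ * gaussMoment 0 γ := by
    rw [ProbabilityTheory.cdf_eq_real, Measure.real,
      ProbabilityTheory.gaussianReal_apply_eq_integral 0 one_ne_zero, ENNReal.toReal_ofReal
        (integral_nonneg fun x => ProbabilityTheory.gaussianPDFReal_nonneg 0 1 x),
      ← integral_indicator measurableSet_Iic,
      ← integral_sub_left_eq_self _ volume γ]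
    have h2 : (fun x => (Iic γ).indicator (ProbabilityTheory.gaussianPDFReal 0 1) (γ - x)) =
        (Ici 0).indicator (fun x => ProbabilityTheory.gaussianPDFReal 0 1 γ *
          (x ^ 0 * Real.exp (γ * x - x ^ 2 / 2))) := by
      funext x
      by_cases hx : 0 ≤ x
      · rw [indicator_of_mem (show γ - x ∈ Iic γ by simpa using hx),
          indicator_of_mem (show x ∈ Ici 0 from hx)]
        simp only [ProbabilityTheory.gaussianPDFReal]
        rw [pow_zero, one_mul, mul_assoc (√_)⁻¹, ← Real.exp_add]
        congr 2
        push_cast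
        ring
      · rw [indicator_of_notMem (show γ - x ∉ Iic γ by simpa using hx),
          indicator_of_notMem (show x ∉ Ici 0 from hx)]
    rw [h2, integral_indicator measurableSet_Ici, integral_Ici_eq_integral_Ioi, integral_const_mul]
    rfl
  have h3 := ProbabilityTheory.gaussianPDFReal_pos 0 1 γ one_ne_zero
  have h4 := gaussMoment_zero_pos γ
  rw [gFun, h1]
  field_simp

/-- This is the form `-b a⁻²` that inverting the expansion `a + bδ` of `δ/B` produces. -/
theorem hFun_eq (γ : ℝ) :
    hFun γ = -(1 / 3 * (γ ^ 3 * gaussMoment 0 γ + (γ ^ 2 + 2))) * (gaussMoment 0 γ)⁻¹ ^ 2 := by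
  have h4 := (gaussMoment_zero_pos γ).ne'
  rw [hFun, gFun_eq]
  field_simp

/-! ### Laplace's method for the Erlang integral. -/

/-- If `E` and `E * exp q` are at most `B`, then `E * exp q` is `E * (1 + m)` up to `d` and
quadratic terms, where `m - d ≤ q ≤ m`. -/
theorem abs_mul_exp_sub_le {E B q m d : ℝ} (hE : 0 ≤ E) (hB : E ≤ B) (hB' : E * Real.exp q ≤ B)
    (q0 : 0 ≤ q) (q1 : q ≤ m) (q2 : m - d ≤ q) :
    |E * Real.exp q - E * (1 + m)| ≤ B * (2 * m ^ 2 + d) := by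
  have x0 := exp_sub_one_sub_le q
  have x1 := Real.add_one_le_exp q
  have hq2 : q ^ 2 ≤ m ^ 2 := pow_le_pow_left₀ q0 q1 2
  have e : E * Real.exp q - E * (1 + m) = E * (Real.exp q - 1 - q) + E * (q - m) := by ring
  have y1 : |E * (Real.exp q - 1 - q)| ≤ m ^ 2 * (B + B) := by
    rw [abs_of_nonneg (mul_nonneg hE (by linarith))]
    calc _ ≤ E * (q ^ 2 * (1 + Real.exp q)) := mul_le_mul_of_nonneg_left x0 hE
      _ = q ^ 2 * (E + E * Real.exp q) := by ring
      _ ≤ m ^ 2 * (B + B) := mul_le_mul hq2 (add_le_add hB hB') (by positivity) (by positivity)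
  have y2 : |E * (q - m)| ≤ B * d := by
    rw [abs_mul, abs_of_nonneg hE]
    refine mul_le_mul hB ?_ (abs_nonneg _) (hE.trans hB)
    rw [abs_of_nonpos (by linarith)]
    linarith
  rw [e]
  refine (abs_add_le _ _).trans ((add_le_add y1 y2).trans (le_of_eq ?_))
  ring

/-- A majorant `e^{-u}` free of `δ` and `γ`. With `c = G + 2` and `w = 1 + δu`, use `u²/(2w) ≥ cu -
c²w/2`. The term `c²δu/2` costs at most `u/2`, and the `2` in `c` leaves `-3u/2 ≤ -u`. -/
theorem erlang_exponent_le {γ G δ u S : ℝ} (hγ : |γ| ≤ G) (hδ : 0 < δ)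
    (hδG : δ * (G + 2) ^ 2 ≤ 1) (hS : S * δ ^ 2 = 1) (hS0 : 0 ≤ S) (hu : 0 ≤ u) :
    -((δ⁻¹ - γ) * u) + S * Real.log (1 + δ * u) ≤ (G + 2) ^ 2 / 2 + -u := by
  have l4 := log_one_add_le (show 0 ≤ δ * u by positivity)
  have hsδ : S * δ = δ⁻¹ := by field_simp; linarith
  have h1 := mul_le_mul_of_nonneg_left l4 hS0
  have h2 : S * ((δ * u) ^ 2 / (2 * (1 + δ * u))) = u ^ 2 / (2 * (1 + δ * u)) := by
    rw [← mul_div_assoc]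
    congr 1
    linear_combination u ^ 2 * hS
  have h3 : (G + 2) * u - (G + 2) ^ 2 * (1 + δ * u) / 2 ≤ u ^ 2 / (2 * (1 + δ * u)) := by
    rw [le_div_iff₀ (by positivity)]
    linarith [sq_nonneg (u - (G + 2) * (1 + δ * u))]
  have h4 : S * (δ * u) = δ⁻¹ * u := by rw [← mul_assoc, hsδ]
  have h5 : γ * u ≤ G * u := mul_le_mul_of_nonneg_right ((le_abs_self γ).trans hγ) hu
  have h6 : δ * (G + 2) ^ 2 * u ≤ 1 * u := mul_le_mul_of_nonneg_right hδG hu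
  rw [mul_sub, h2, h4] at h1
  linarith

/-- Second order Laplace expansion of the integrand of the reciprocal Erlang B probability. -/
theorem abs_integrand_sub_le {γ G δ u : ℝ} {s : ℕ} (hγ : |γ| ≤ G) (hδ : 0 < δ)
    (hδG : δ * (G + 2) ^ 2 ≤ 1) (hs : (s : ℝ) * δ ^ 2 = 1) (hu : 0 ≤ u) :
    |Real.exp (-((δ⁻¹ - γ) * u)) * (1 + δ * u) ^ s -
      (u ^ 0 * Real.exp (γ * u - u ^ 2 / 2) +
        δ / 3 * (u ^ 3 * Real.exp (γ * u - u ^ 2 / 2)))| ≤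
      δ ^ 2 * Real.exp ((G + 2) ^ 2 / 2) * (u ^ 4 * Real.exp (-u) + u ^ 6 * Real.exp (-u)) := by
  have hv : 0 ≤ δ * u := by positivity
  obtain ⟨l1, l2, l3⟩ := log_one_add_bounds hv
  have hs0 : (0 : ℝ) ≤ s := s.cast_nonneg
  have hexp := erlang_exponent_le hγ hδ hδG hs hs0 hu
  have hsδ : (s : ℝ) * δ = δ⁻¹ := by field_simp; linarith
  have hpow : Real.exp (-((δ⁻¹ - γ) * u)) * (1 + δ * u) ^ s =
      Real.exp (-((δ⁻¹ - γ) * u) + s * Real.log (1 + δ * u)) := by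
    rw [Real.exp_add, Real.exp_nat_mul, Real.exp_log (by positivity)]
  rw [hpow]
  generalize Real.log (1 + δ * u) = ℓ at l1 l2 l3 hexp ⊢
  -- `q` is what the exponent adds to `γu - u²/2`. It lies between `δu³/3 - δ²u⁴/4` and `δu³/3`.
  obtain ⟨q, hq⟩ : ∃ q, q = (s : ℝ) * (ℓ - δ * u + (δ * u) ^ 2 / 2) := ⟨_, rfl⟩
  have q0 : 0 ≤ q := hq ▸ mul_nonneg hs0 l1
  have q1 : q ≤ δ / 3 * u ^ 3 := by
    rw [hq]
    refine (mul_le_mul_of_nonneg_left l2 hs0).trans (le_of_eq ?_)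
    linear_combination (δ * u ^ 3 / 3) * hs
  have q2 : δ / 3 * u ^ 3 - δ ^ 2 / 4 * u ^ 4 ≤ q := by
    rw [hq]
    refine le_trans (le_of_eq ?_) (mul_le_mul_of_nonneg_left l3 hs0)
    linear_combination (-(δ * u ^ 3 / 3) + δ ^ 2 * u ^ 4 / 4) * hs
  have e1 : -((δ⁻¹ - γ) * u) + s * ℓ = (γ * u - u ^ 2 / 2) + q := by
    rw [hq, ← hsδ]
    linear_combination -(u ^ 2 / 2) * hs
  rw [e1] at hexp ⊢
  have hb1 := Real.exp_le_exp.2 hexp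
  rw [Real.exp_add, Real.exp_add] at hb1
  have key := abs_mul_exp_sub_le (Real.exp_pos _).le (exp_gauss_le hγ hu) hb1 q0 q1 q2
  rw [Real.exp_add]
  have e2 : ∀ E : ℝ, u ^ 0 * E + δ / 3 * (u ^ 3 * E) = E * (1 + δ / 3 * u ^ 3) := fun E => by ring
  rw [e2]
  refine key.trans ?_
  have e3 : δ ^ 2 * Real.exp ((G + 2) ^ 2 / 2) *
      (u ^ 4 * Real.exp (-u) + u ^ 6 * Real.exp (-u)) =
      Real.exp ((G + 2) ^ 2 / 2) * Real.exp (-u) * (δ ^ 2 * (u ^ 4 + u ^ 6)) := by ring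
  rw [e3]
  refine mul_le_mul_of_nonneg_left ?_ (by positivity)
  have z1 : 0 ≤ δ ^ 2 * u ^ 4 := by positivity
  have z2 : 0 ≤ δ ^ 2 * u ^ 6 := by positivity
  linarith

theorem abs_erlang_integral_sub_le {γ G δ : ℝ} {s : ℕ} (hγ : |γ| ≤ G) (hδ : 0 < δ)
    (hδG : δ * (G + 2) ^ 2 ≤ 1) (hs : (s : ℝ) * δ ^ 2 = 1) :
    |(∫ u in Ioi (0 : ℝ), Real.exp (-((δ⁻¹ - γ) * u)) * (1 + δ * u) ^ s) -
      (gaussMoment 0 γ + δ / 3 * gaussMoment 3 γ)| ≤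
      744 * Real.exp ((G + 2) ^ 2 / 2) * δ ^ 2 := by
  have hpt := fun u (hu : u ∈ Ioi (0 : ℝ)) =>
    abs_integrand_sub_le hγ hδ hδG hs (le_of_lt hu)
  have i0 := integrableOn_gaussMoment 0 γ
  have i3 := (integrableOn_gaussMoment 3 γ).const_mul (δ / 3)
  have j4 := integrableOn_pow_mul_exp_neg one_pos 4
  have j6 := integrableOn_pow_mul_exp_neg one_pos 6
  have v4 := integral_pow_mul_exp_neg one_pos 4
  have v6 := integral_pow_mul_exp_neg one_pos 6
  simp only [one_mul] at j4 j6 v4 v6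
  have jb := (j4.add j6).const_mul (δ ^ 2 * Real.exp ((G + 2) ^ 2 / 2))
  have hae := (ae_restrict_iff' (μ := volume) measurableSet_Ioi).2 (Eventually.of_forall hpt)
  have hcont : Continuous fun u : ℝ => Real.exp (-((δ⁻¹ - γ) * u)) * (1 + δ * u) ^ s -
      (u ^ 0 * Real.exp (γ * u - u ^ 2 / 2) +
        δ / 3 * (u ^ 3 * Real.exp (γ * u - u ^ 2 / 2))) := by fun_prop
  have hdiff := Integrable.mono' jb hcont.aestronglyMeasurable hae
  have hsum := hdiff.add (i0.add i3)
  have hT : IntegrableOn (fun u => Real.exp (-((δ⁻¹ - γ) * u)) * (1 + δ * u) ^ s) (Ioi 0) := by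
    refine Integrable.congr hsum (Eventually.of_forall fun u => ?_)
    simp only [Pi.add_apply]
    ring
  have e : (∫ u in Ioi (0 : ℝ), Real.exp (-((δ⁻¹ - γ) * u)) * (1 + δ * u) ^ s) -
      (gaussMoment 0 γ + δ / 3 * gaussMoment 3 γ) =
      ∫ u in Ioi (0 : ℝ), (Real.exp (-((δ⁻¹ - γ) * u)) * (1 + δ * u) ^ s -
        (u ^ 0 * Real.exp (γ * u - u ^ 2 / 2) +
          δ / 3 * (u ^ 3 * Real.exp (γ * u - u ^ 2 / 2)))) := by
    have iM : IntegrableOn (fun u => u ^ 0 * Real.exp (γ * u - u ^ 2 / 2) +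
      δ / 3 * (u ^ 3 * Real.exp (γ * u - u ^ 2 / 2))) (Ioi 0) := i0.add i3
    rw [integral_sub hT iM, integral_add i0 i3, integral_const_mul]
    rfl
  rw [e]
  refine abs_integral_le_integral_abs.trans ((integral_mono_ae hdiff.abs jb hae).trans ?_)
  rw [integral_const_mul]
  simp only [Pi.add_apply]
  rw [integral_add j4 j6, v4, v6]
  -- The moments of `e^{-u}`: `4! + 6! = 744`.
  have : (((4).factorial : ℝ) / 1 ^ (4 + 1) + ((6).factorial : ℝ) / 1 ^ (6 + 1)) = 744 := by
    norm_num [Nat.factorial]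
  rw [this]
  exact le_of_eq (by ring)

/-- The load is `a/δ` with `a = 1/δ - γ`, so `δ/B` is `1 - γδ` times the integral `J_0 + δJ_3/3 +
O(δ²)`. Its first-order coefficient `J_3/3 - γJ_0` simplifies by `gaussMoment_three`. -/
theorem hasExpansion_erlangInv {C : Set ℝ} {G : ℝ} (hC : ∀ γ ∈ C, |γ| ≤ G) :
    HasExpansion (unifAtTop C) invSqrt
      (fun x => invSqrt x * erlangInv x.1 (x.1 * (1 - x.2 / √(x.1 : ℝ))))
      (fun x => gaussMoment 0 x.2)
      (fun x => 1 / 3 * (x.2 ^ 3 * gaussMoment 0 x.2 + (x.2 ^ 2 + 2))) := by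
  have hδ := tendsto_invSqrt C
  have hpos := eventually_invSqrt_pos C
  have hsmall : ∀ (K : ℝ), ∀ᶠ x in unifAtTop C, invSqrt x * K < 1 := by
    intro K
    have : Tendsto (fun x => invSqrt x * K) (unifAtTop C) (𝓝 (0 * K)) := hδ.mul_const K
    rw [zero_mul] at this
    exact this.eventually (gt_mem_nhds one_pos)
  have hJ : ∀ n, (fun x : ℕ × ℝ => gaussMoment n x.2) =O[unifAtTop C] (fun _ => (1 : ℝ)) :=
    fun n => isBigO_one_of_bound fun γ hγ => by
      rw [abs_of_nonneg (gaussMoment_nonneg n γ)]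
      exact gaussMoment_le n (hC γ hγ)
  have hid : (fun x : ℕ × ℝ => x.2) =O[unifAtTop C] (fun _ => (1 : ℝ)) :=
    isBigO_one_of_bound (u := fun γ => γ) hC
  have hsδ : ∀ᶠ x in unifAtTop C, (x.1 : ℝ) * invSqrt x ^ 2 = 1 := by
    refine eventually_unifAtTop.2 ⟨1, fun s hs γ _ => ?_⟩
    have : (0 : ℝ) < s := by exact_mod_cast hs
    rw [invSqrt, inv_pow, Real.sq_sqrt this.le, mul_inv_cancel₀ this.ne']
  have hint : HasExpansion (unifAtTop C) invSqrt
      (fun x => ∫ u in Ioi (0 : ℝ), Real.exp (-(((invSqrt x)⁻¹ - x.2) * u)) *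
        (1 + invSqrt x * u) ^ x.1)
      (fun x => gaussMoment 0 x.2) (fun x => 1 / 3 * gaussMoment 3 x.2) := by
    refine ⟨hJ 0, (hJ 3).const_mul_left _, ?_⟩
    refine IsBigO.of_bound (744 * Real.exp ((G + 2) ^ 2 / 2)) ?_
    filter_upwards [eventually_mem_unifAtTop C, hpos, hsmall ((G + 2) ^ 2), hsδ]
      with x hx h1 h2 h3
    rw [Real.norm_eq_abs, Real.norm_of_nonneg (sq_nonneg _)]
    refine le_trans (le_of_eq ?_) (abs_erlang_integral_sub_le (hC _ hx) h1 h2.le h3)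
    congr 1
    ring
  have hlin : HasExpansion (unifAtTop C) invSqrt (fun x => 1 - x.2 * invSqrt x)
      (fun _ => 1) (fun x => -x.2) :=
    HasExpansion.of_eq (isBigO_const_const _ one_ne_zero _) hid.neg_left fun x => by ring
  have hmul := hlin.mul hδ hint
  refine ⟨hJ 0, ?_, ?_⟩
  · refine (hmul.right).congr_left fun x => ?_
    rw [gaussMoment_three]
    ring
  · refine (hmul.rem).congr' ?_ EventuallyEq.rfl
    filter_upwards [eventually_mem_unifAtTop C, hpos, hsmall G, hsδ] with x hx h1 h2 h3
    have h4 : x.2 < (invSqrt x)⁻¹ := by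
      rw [← one_div, lt_div_iff₀ h1]
      have := mul_le_mul_of_nonneg_right ((le_abs_self x.2).trans (hC _ hx)) h1.le
      linarith
    have h5 : (x.1 : ℝ) * (1 - x.2 / √(x.1 : ℝ)) = ((invSqrt x)⁻¹ - x.2) / invSqrt x := by
      rw [div_eq_mul_inv x.2]
      change (x.1 : ℝ) * (1 - x.2 * invSqrt x) = _
      field_simp
      linear_combination (1 - x.2 * invSqrt x) * h3
    have h6 : invSqrt x * ((invSqrt x)⁻¹ - x.2) = 1 - x.2 * invSqrt x := by
      rw [mul_sub, mul_inv_cancel₀ h1.ne', mul_comm]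
    rw [h5, erlangInv_eq_integral x.1 (sub_pos.2 h4) h1, ← mul_assoc (invSqrt x), h6,
      gaussMoment_three]
    ring


/-! ### Smooth profiles and the degenerate case `γ 𝓛(γ) = 1`. -/

theorem IsSmoothScalingProfile.expIntegrable {f : ℝ → ℝ} (hf : IsSmoothScalingProfile f) {r : ℝ}
    (hr : gammaMin f < (r : EReal)) :
    ExpIntegrable f (iteratedDerivWithin 1 f (Ici 0)) (iteratedDerivWithin 2 f (Ici 0)) r := by
  have hu : UniqueDiffOn ℝ (Ici (0 : ℝ)) := uniqueDiffOn_Ici 0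
  have hd : ∀ (n : ℕ), n < 4 → ∀ x : ℝ, 0 < x →
      HasDerivAt (iteratedDerivWithin n f (Ici 0)) (iteratedDerivWithin (n + 1) f (Ici 0) x) x := by
    intro n hn x hx
    have h1 : DifferentiableOn ℝ (iteratedDerivWithin n f (Ici 0)) (Ici 0) :=
      hf.contDiffOn.differentiableOn_iteratedDerivWithin (by exact_mod_cast hn) hu
    rw [iteratedDerivWithin_succ]
    exact (h1 x hx.le).hasDerivWithinAt.hasDerivAt (Ici_mem_nhds hx)
  have hc : ∀ n : ℕ, n ≤ 4 → ContinuousOn (iteratedDerivWithin n f (Ici 0)) (Ici 0) :=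
    fun n hn => hf.contDiffOn.continuousOn_iteratedDerivWithin (by exact_mod_cast hn) hu
  have hi := hf.integrable r hr
  refine ⟨hf.nonneg, hf.contDiffOn.continuousOn, hc 1 (by norm_num), hc 2 (by norm_num), ?_,
    hd 1 (by norm_num), ?_, hi 1 (by norm_num), hi 2 (by norm_num)⟩
  · simpa only [iteratedDerivWithin_zero] using hd 0 (by norm_num)
  · simpa only [iteratedDerivWithin_zero] using hi 0 (by norm_num)

theorem IsSmoothScalingProfile.laplace_le {f : ℝ → ℝ} (hf : IsSmoothScalingProfile f) {β : ℝ}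
    (hβ : 0 < β) : laplace f β ≤ β⁻¹ := by
  have h1 := integrableOn_pow_mul_exp_neg hβ 0
  have h2 := integral_pow_mul_exp_neg hβ 0
  simp only [pow_zero, one_mul, zero_add, pow_one, Nat.factorial_zero, Nat.cast_one, one_div]
    at h1 h2
  rw [laplace, integral_Ici_eq_integral_Ioi, ← h2]
  refine integral_mono_of_nonneg ?_ h1 ?_
  · refine (ae_restrict_iff' measurableSet_Ioi).2 (Eventually.of_forall fun x hx => ?_)
    exact mul_nonneg (Real.exp_pos _).le (hf.nonneg x (le_of_lt hx))
  · refine (ae_restrict_iff' measurableSet_Ioi).2 (Eventually.of_forall fun x hx => ?_)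
    have h3 : f x ≤ 1 :=
      hf.map_zero ▸ hf.antitone self_mem_Ici (mem_Ici.2 (le_of_lt hx)) (le_of_lt hx)
    simp only [neg_mul]
    exact mul_le_of_le_one_right (Real.exp_pos _).le h3

/-- The maximal value `1` of `γ 𝓛(γ)` is attained only with `𝓛'(γ) = -1 / γ²`. -/
theorem IsSmoothScalingProfile.mul_laplace_add_mFun_eq_zero {f : ℝ → ℝ}
    (hf : IsSmoothScalingProfile f) {γ : ℝ} (hγ : gammaMin f < (γ : EReal))
    (h : 1 - γ * laplace f γ = 0) : γ * laplace f γ + mFun f γ = 0 := by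
  obtain ⟨r, hr1, hr2⟩ := EReal.lt_iff_exists_real_btwn.1 hγ
  have hE := hf.expIntegrable hr1
  have hL0 := hE.laplace_nonneg γ
  have hd := hE.hasDerivAt_laplace (EReal.coe_lt_coe_iff.1 hr2)
  have hpos : 0 < γ := by
    by_contra hn
    nlinarith [not_lt.1 hn]
  have hd2 : HasDerivAt (fun β => β⁻¹ - laplace f β) (-(γ ^ 2)⁻¹ - laplaceDeriv f γ) γ :=
    (hasDerivAt_inv hpos.ne').sub hd
  -- `f ≤ 1` gives `𝓛(β) ≤ 1/β` for `β > 0`, with equality at `γ`, so the difference has an interior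
  -- minimum there.
  have hmin : IsLocalMin (fun β => β⁻¹ - laplace f β) γ := by
    filter_upwards [lt_mem_nhds hpos] with β hβ
    have h1 : laplace f γ = γ⁻¹ := by field_simp; linarith
    rw [h1, sub_self]
    exact sub_nonneg.2 (hf.laplace_le hβ)
  have h0 := hmin.hasDerivAt_eq_zero hd2
  rw [mFun, hd.deriv]
  have h2 : γ ^ 2 * laplaceDeriv f γ = -1 := by
    have : laplaceDeriv f γ = -(γ ^ 2)⁻¹ := by linarith
    rw [this]
    field_simp
  linarith

/-! ### From uniform expansions to explicit bounds. -/

/-- An expansion uniform in `γ ∈ C` gives a bound for all `s`, if the quantity of interest is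
a priori at most `√s`. -/
theorem HasExpansion.exists_uniform_bound {C : Set ℝ} {F : ℕ × ℝ → ℝ} {a b : ℝ → ℝ}
    (hF : HasExpansion (unifAtTop C) invSqrt F (fun x => a x.2) (fun x => b x.2))
    {P : ℕ → ℝ → ℝ → Prop} (hB : ∀ s, 1 ≤ s → ∀ γ ∈ C, ∀ d, P s γ d → |d| ≤ √(s : ℝ))
    (hP : ∀ᶠ x in unifAtTop C, ∀ d, P x.1 x.2 d → d = F x) :
    ∃ K : ℝ, ∀ s : ℕ, 1 ≤ s → ∀ γ ∈ C, ∀ d, P s γ d →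
      |d - (a γ + 1 / √(s : ℝ) * b γ)| ≤ K * (1 / (s : ℝ)) := by
  obtain ⟨Ka, hKa⟩ := hF.left.bound
  obtain ⟨Kb, hKb⟩ := hF.right.bound
  obtain ⟨K, hK⟩ := hF.rem.bound
  obtain ⟨s₀, hs₀⟩ := eventually_unifAtTop.1 (hKa.and (hKb.and (hK.and hP)))
  refine ⟨|K| + (√(s₀ : ℝ) + |Ka| + |Kb|) * s₀, fun s hs γ hγ d hd => ?_⟩
  have hs0 : (0 : ℝ) < s := by exact_mod_cast hs
  have hpos : 0 < 1 / (s : ℝ) := by positivity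
  rw [add_mul]
  by_cases hle : s₀ ≤ s
  · obtain ⟨-, -, h1, h2⟩ := hs₀ s hle γ hγ
    have h3 : ‖invSqrt (s, γ) ^ 2‖ = 1 / (s : ℝ) := by
      rw [Real.norm_of_nonneg (sq_nonneg _), invSqrt, inv_pow, Real.sq_sqrt hs0.le, one_div]
    have h4 : F (s, γ) - a γ - b γ * invSqrt (s, γ) = d - (a γ + 1 / √(s : ℝ) * b γ) := by
      rw [← h2 d hd, invSqrt]
      ring
    rw [h3] at h1
    simp only [h4, Real.norm_eq_abs] at h1
    have h5 : K * (1 / (s : ℝ)) ≤ |K| * (1 / (s : ℝ)) :=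
      mul_le_mul_of_nonneg_right (le_abs_self K) hpos.le
    have h6 : 0 ≤ (√(s₀ : ℝ) + |Ka| + |Kb|) * s₀ * (1 / (s : ℝ)) := by positivity
    linarith
  · obtain ⟨h1, h2, -, -⟩ := hs₀ s₀ le_rfl γ hγ
    -- The coefficients do not depend on `s`, so their bounds on `C`, read off at `s₀`, also serve
    -- every smaller `s`.
    simp only [Real.norm_eq_abs, abs_one, mul_one] at h1 h2
    have hss : (s : ℝ) ≤ s₀ := by exact_mod_cast (not_le.1 hle).le
    have h3 : |d| ≤ √(s₀ : ℝ) := (hB s hs γ hγ d hd).trans (Real.sqrt_le_sqrt hss)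
    have h4 : 1 ≤ √(s : ℝ) := Real.one_le_sqrt.2 (by exact_mod_cast hs)
    have h5 : |1 / √(s : ℝ) * b γ| ≤ |Kb| := by
      rw [abs_mul, abs_of_nonneg (by positivity)]
      have : 1 / √(s : ℝ) ≤ 1 := by rw [div_le_one (by positivity)]; exact h4
      calc _ ≤ 1 * |b γ| := mul_le_mul_of_nonneg_right this (abs_nonneg _)
        _ ≤ |Kb| := by rw [one_mul]; exact h2.trans (le_abs_self _)
    have h6 : |d - (a γ + 1 / √(s : ℝ) * b γ)| ≤ √(s₀ : ℝ) + |Ka| + |Kb| := by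
      have e : d - (a γ + 1 / √(s : ℝ) * b γ) = d + -(a γ) + -(1 / √(s : ℝ) * b γ) := by ring
      rw [e]
      refine (abs_add_three _ _ _).trans ?_
      rw [abs_neg, abs_neg]
      exact add_le_add (add_le_add h3 (h1.trans (le_abs_self _))) h5
    have h7 : 1 ≤ (s₀ : ℝ) * (1 / (s : ℝ)) := by
      rw [mul_one_div, le_div_iff₀ hs0, one_mul]
      exact hss
    have h8 : 0 ≤ |K| * (1 / (s : ℝ)) := by positivity
    have h9 := mul_le_mul_of_nonneg_left h7
      (show 0 ≤ √(s₀ : ℝ) + |Ka| + |Kb| by positivity)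
    rw [mul_assoc]
    linarith

/-- The reciprocal of `√s π_s`, where `π` is the stationary distribution. -/
noncomputable def invMass (f : ℝ → ℝ) (x : ℕ × ℝ) : ℝ :=
  invSqrt x * erlangInv x.1 (x.1 * (1 - x.2 / √(x.1 : ℝ))) + -invSqrt x +
    invSqrt x * waitSum f x.1 x.2

section expansions

variable {f : ℝ → ℝ} {C : Set ℝ}

/-- Two rates are needed below `C`: integrability holds at `r`, and the gap up to `r₀` absorbs the
powers of `x`. For empty `C` one only needs `gammaMin f < ⊤`, which follows from `f ≤ 1`. -/
theorem IsSmoothScalingProfile.exists_bounds (hf : IsSmoothScalingProfile f) (hC : IsCompact C)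
    (hγ : ∀ γ ∈ C, gammaMin f < (γ : EReal)) :
    ∃ r r₀ G : ℝ, gammaMin f < (r : EReal) ∧ r < r₀ ∧ ∀ γ ∈ C, r₀ ≤ γ ∧ |γ| ≤ G := by
  rcases C.eq_empty_or_nonempty with rfl | hne
  · have h1 : gammaMin f < ⊤ := by
      refine lt_of_le_of_lt (sInf_le (mem_image_of_mem _ (x := (1 : ℝ)) ?_)) (EReal.coe_lt_top 1)
      have h1 := integrableOn_pow_mul_exp_neg one_pos 0
      have h2 : IntegrableOn (fun u : ℝ => Real.exp (-1 * u)) (Ici 0) := by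
        rw [integrableOn_Ici_iff_integrableOn_Ioi]
        simpa using h1
      refine (ExpIntegrable.integrable_of_abs_le (K := 1) h2
        (G := fun x => Real.exp (-1 * x) * f x)
        (ContinuousOn.mul (by fun_prop) hf.contDiffOn.continuousOn) fun x hx => ?_).1
      have h3 : f x ≤ 1 := hf.map_zero ▸ hf.antitone self_mem_Ici hx hx
      rw [abs_mul, one_mul, abs_of_nonneg (hf.nonneg x hx)]
      exact mul_le_of_le_one_right (abs_nonneg _) h3
    obtain ⟨r, hr, -⟩ := EReal.lt_iff_exists_real_btwn.1 h1
    exact ⟨r, r + 1, 0, hr, by linarith, by simp⟩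
  · obtain ⟨c, hc, hmin⟩ := hC.exists_isLeast hne
    obtain ⟨G, hG⟩ := hC.isBounded.exists_norm_le
    obtain ⟨r₀, hr1, hr2⟩ := EReal.lt_iff_exists_real_btwn.1 (hγ c hc)
    obtain ⟨r, hr3, hr4⟩ := EReal.lt_iff_exists_real_btwn.1 hr1
    exact ⟨r, r₀, G, hr3, EReal.coe_lt_coe_iff.1 hr4, fun γ h =>
      ⟨(EReal.coe_lt_coe_iff.1 hr2).le.trans (hmin h), hG γ h⟩⟩

/-- Both quotients have denominators with leading term `J_0(γ) + 𝓛(γ)`. It is at least `J_0(r₀) >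
0`, since `J_0` increases and `𝓛 ≥ 0`, so inversion is uniform on `C`. -/
theorem IsSmoothScalingProfile.hasExpansions (hf : IsSmoothScalingProfile f) (hC : IsCompact C)
    (hγ : ∀ γ ∈ C, gammaMin f < (γ : EReal)) :
    HasExpansion (unifAtTop C) invSqrt
      (fun x => invSqrt x * waitSum f x.1 x.2 * (invMass f x)⁻¹)
      (fun x => T1 f x.2) (fun x => T2 f x.2) ∧
    HasExpansion (unifAtTop C) invSqrt
      (fun x => (1 + -x.2 * (invSqrt x * waitSum f x.1 x.2)) *
        ((1 + -x.2 * invSqrt x) * invMass f x)⁻¹)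
      (fun x => T1R f x.2) (fun x => T2R f x.2) := by
  obtain ⟨r, r₀, G, hr, hr₀, hb⟩ := hf.exists_bounds hC hγ
  have hE := hf.expIntegrable hr
  have hδ := tendsto_invSqrt C
  have hσ := hE.hasExpansion_waitSum hf.map_zero hr₀ hb
  have hy := hasExpansion_erlangInv fun γ h => (hb γ h).2
  have hid : (fun x : ℕ × ℝ => x.2) =O[unifAtTop C] (fun _ => (1 : ℝ)) :=
    isBigO_one_of_bound (u := fun γ => γ) fun γ h => (hb γ h).2
  have h0 : (fun _ : ℕ × ℝ => (0 : ℝ)) =O[unifAtTop C] (fun _ => (1 : ℝ)) := isBigO_zero _ _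
  have h1 : (fun _ : ℕ × ℝ => (1 : ℝ)) =O[unifAtTop C] (fun _ => (1 : ℝ)) := isBigO_refl _ _
  have hneg : HasExpansion (unifAtTop C) invSqrt (fun x => -invSqrt x) (fun _ => 0)
      (fun _ => -1) := .of_eq h0 (isBigO_const_const _ one_ne_zero _) fun x => by ring
  have hone : HasExpansion (unifAtTop C) invSqrt (fun _ => 1) (fun _ => 1)
      (fun _ => 0) := .of_eq h1 h0 fun x => by ring
  have hγ' : HasExpansion (unifAtTop C) invSqrt (fun x => -x.2) (fun x => -x.2)
      (fun _ => 0) := .of_eq hid.neg_left h0 fun x => by ring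
  have hlin : HasExpansion (unifAtTop C) invSqrt (fun x => 1 + -x.2 * invSqrt x) (fun _ => 1)
      (fun x => -x.2) := .of_eq h1 hid.neg_left fun x => rfl
  have hZ := (hy.add hneg).add hσ
  have hm := gaussMoment_zero_pos r₀
  have hlow : ∀ᶠ x in unifAtTop C,
      gaussMoment 0 r₀ ≤ gaussMoment 0 x.2 + 0 + laplace f x.2 := by
    filter_upwards [eventually_mem_unifAtTop C] with x hx
    have := gaussMoment_zero_mono (hb _ hx).1
    have := hE.laplace_nonneg x.2
    linarith
  have hlow' : ∀ᶠ x in unifAtTop C,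
      gaussMoment 0 r₀ ≤ 1 * (gaussMoment 0 x.2 + 0 + laplace f x.2) := by
    simpa only [one_mul] using hlow
  have hD := hσ.mul hδ (hZ.inv hδ hm hlow)
  have hR := (hone.add (hγ'.mul hδ hσ)).mul hδ ((hlin.mul hδ hZ).inv hδ hm hlow')
  have hderiv : ∀ x : ℕ × ℝ, x.2 ∈ C → deriv (laplace f) x.2 = laplaceDeriv f x.2 := fun x hx =>
    (hE.hasDerivAt_laplace (hr₀.trans_le (hb _ hx).1)).deriv
  have congr : ∀ {F a b a' b' : ℕ × ℝ → ℝ}, HasExpansion (unifAtTop C) invSqrt F a b →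
      (∀ x : ℕ × ℝ, x.2 ∈ C → a x = a' x ∧ b x = b' x) →
      HasExpansion (unifAtTop C) invSqrt F a' b' := by
    intro F a b a' b' h hab
    have hmem := eventually_mem_unifAtTop C
    refine ⟨h.left.congr' ?_ .rfl, h.right.congr' ?_ .rfl, h.rem.congr' ?_ .rfl⟩ <;>
    filter_upwards [hmem] with x hx
    · exact (hab x hx).1
    · exact (hab x hx).2
    · rw [(hab x hx).1, (hab x hx).2]
  refine ⟨congr hD fun x hx => ?_, congr hR fun x hx => ?_⟩
  · have hJ := gaussMoment_zero_pos x.2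
    have hL := hE.laplace_nonneg x.2
    have hder := hderiv x hx
    simp only [T1, T2, mFun, gFun_eq, hFun_eq, hder]
    generalize gaussMoment 0 x.2 = J at *
    generalize laplace f x.2 = L at *
    generalize laplaceDeriv f x.2 = L1 at *
    have hJL : J + L ≠ 0 := by positivity
    have hgL : 1 + J⁻¹ * L ≠ 0 := by positivity
    constructor
    · rw [add_zero]; field_simp
    · rw [add_zero]; field_simp; ring
  · have hJ := gaussMoment_zero_pos x.2
    have hL := hE.laplace_nonneg x.2
    have hder := hderiv x hx
    have hdeg := hf.mul_laplace_add_mFun_eq_zero (hγ _ hx)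
    -- The cancellation also holds for a zero denominator: division by zero gives `0`, and the right
    -- side vanishes by `mul_laplace_add_mFun_eq_zero`.
    have hX : (1 - x.2 * laplace f x.2) *
        ((x.2 * laplace f x.2 + mFun f x.2) / (1 - x.2 * laplace f x.2)) =
        x.2 * laplace f x.2 + mFun f x.2 := by
      by_cases hz : 1 - x.2 * laplace f x.2 = 0
      · rw [hdeg hz, hz]; simp
      · field_simp
    have hT : T2R f x.2 = (1 + gFun x.2 * laplace f x.2)⁻¹ *
        ((1 - x.2 * laplace f x.2) * hFun x.2 -
          x.2 * gFun x.2 * (x.2 * laplace f x.2 + mFun f x.2) -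
          (1 - x.2 * laplace f x.2) * (gFun x.2 *
            ((hFun x.2 * laplace f x.2 + gFun x.2 * mFun f x.2) /
              (1 + gFun x.2 * laplace f x.2)))) := by
      rw [← hX, T2R]
      ring
    rw [hT]
    simp only [T1R, mFun, gFun_eq, hFun_eq, hder]
    clear hT hX hdeg hder
    generalize gaussMoment 0 x.2 = J at *
    generalize laplace f x.2 = L at *
    generalize laplaceDeriv f x.2 = L1 at *
    generalize x.2 = γ at *
    have hJL : J + L ≠ 0 := by positivity
    have hgL : 1 + J⁻¹ * L ≠ 0 := by positivity
    constructor
    · rw [add_zero]; field_simp; ring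
    · rw [add_zero]; field_simp; ring

end expansions

/-! ### Identification of the probabilities with the expanded quotients. -/

section identification

variable {f : ℝ → ℝ} {s : ℕ} {γ : ℝ} {p π : ℕ → ℝ}

theorem IsStationaryDist.mul_invMass (hf0 : f 0 = 1) (hs : 1 ≤ s) (hγ : γ < √(s : ℝ))
    (hp : IsGlobalControl f s p) (hπ : IsStationaryDist s (s * (1 - γ / √(s : ℝ))) p π) :
    π s * invMass f (s, γ) = invSqrt (s, γ) := by
  have h := hπ.normalization hf0 hs hγ hp
  simp only [invMass]
  linear_combination invSqrt (s, γ) * h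

theorem invSqrt_pos (hs : 1 ≤ s) (γ : ℝ) : 0 < invSqrt (s, γ) := by
  have : (0 : ℝ) < s := by exact_mod_cast hs
  unfold invSqrt
  positivity

theorem IsStationaryDist.delayProb_eq_mul_inv (hf0 : f 0 = 1) (hs : 1 ≤ s)
    (hγ : γ < √(s : ℝ)) (hp : IsGlobalControl f s p)
    (hπ : IsStationaryDist s (s * (1 - γ / √(s : ℝ))) p π) :
    delayProb s π = invSqrt (s, γ) * waitSum f s γ * (invMass f (s, γ))⁻¹ := by
  have h := hπ.mul_invMass hf0 hs hγ hp
  have h1 : invMass f (s, γ) ≠ 0 := fun h0 => by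
    rw [h0, mul_zero] at h
    exact (invSqrt_pos hs γ).ne h
  rw [hπ.delayProb_eq hf0 hs hp, ← h]
  field_simp

theorem IsStationaryDist.sqrt_mul_rejectProb_eq (hf0 : f 0 = 1) (hs : 1 ≤ s)
    (hγ : γ < √(s : ℝ)) (hp : IsGlobalControl f s p)
    (hπ : IsStationaryDist s (s * (1 - γ / √(s : ℝ))) p π)
    (hsum : Summable fun k : ℕ => (1 - γ / √(s : ℝ)) ^ k * f (k / √(s : ℝ))) :
    √(s : ℝ) * rejectProb s p π = (1 + -γ * (invSqrt (s, γ) * waitSum f s γ)) *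
        ((1 + -γ * invSqrt (s, γ)) * invMass f (s, γ))⁻¹ := by
  have hδ := invSqrt_pos hs γ
  have h := hπ.mul_invMass hf0 hs hγ hp
  have h1 : invMass f (s, γ) ≠ 0 := fun h0 => by
    rw [h0, mul_zero] at h
    exact hδ.ne h
  have h2 := hπ.rejectProb_eq hf0 hs hp hsum
  have hsq : 0 < √(s : ℝ) := by positivity
  have h3 : √(s : ℝ) * invSqrt (s, γ) = 1 := mul_inv_cancel₀ hsq.ne'
  have h4 : γ / √(s : ℝ) = γ * invSqrt (s, γ) := div_eq_mul_inv _ _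
  have h5 : 1 + -γ * invSqrt (s, γ) ≠ 0 := by
    have : γ / √(s : ℝ) < 1 := by rwa [div_lt_one hsq]
    rw [h4] at this
    linarith
  rw [h4] at h2
  rw [eq_mul_inv_iff_mul_eq₀ (mul_ne_zero h5 h1)]
  linear_combination √(s : ℝ) * invMass f (s, γ) * h2 +
    √(s : ℝ) * (1 - γ * invSqrt (s, γ) * waitSum f s γ) * h +
    (1 - γ * invSqrt (s, γ) * waitSum f s γ) * h3

end identification

end

end QEDControl

open QEDControl
theorem theorem4p10 (f : ℝ → ℝ) (hf : IsSmoothScalingProfile f) :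
    -- for `γ_min < γ ≤ √s` the stationary distribution exists and is unique
    (∀ s : ℕ, 1 ≤ s → ∀ γ : ℝ, gammaMin f < (γ : EReal) → γ ≤ √(s : ℝ) →
      ∀ p : ℕ → ℝ, IsGlobalControl f s p →
        ∃! π : ℕ → ℝ, IsStationaryDist s (s * (1 - γ / √(s : ℝ))) p π) ∧
    -- corrected approximations, uniformly on compact subsets of `(γ_min, ∞)`
    (∀ C : Set ℝ, IsCompact C → (∀ γ ∈ C, gammaMin f < (γ : EReal)) →
      (∃ K : ℝ, ∀ s : ℕ, 1 ≤ s → ∀ γ ∈ C, γ ≤ √(s : ℝ) →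
        ∀ p π : ℕ → ℝ, IsGlobalControl f s p →
          IsStationaryDist s (s * (1 - γ / √(s : ℝ))) p π →
          |delayProb s π - (T1 f γ + 1 / √(s : ℝ) * T2 f γ)| ≤ K * (1 / (s : ℝ))) ∧
      (∃ K : ℝ, ∀ s : ℕ, 1 ≤ s → ∀ γ ∈ C, γ ≤ √(s : ℝ) →
        ∀ p π : ℕ → ℝ, IsGlobalControl f s p →
          IsStationaryDist s (s * (1 - γ / √(s : ℝ))) p π →
          |rejectProb s p π - (1 / √(s : ℝ) * T1R f γ + 1 / (s : ℝ) * T2R f γ)| ≤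
            K * (1 / ((s : ℝ) * √(s : ℝ))))) := by
  have hsum : ∀ s : ℕ, 1 ≤ s → ∀ γ : ℝ, gammaMin f < (γ : EReal) → γ ≤ √(s : ℝ) →
      Summable fun k : ℕ => (1 - γ / √(s : ℝ)) ^ k * f (k / √(s : ℝ)) := fun s hs γ hγ hle =>
    (hf.expIntegrable hγ).summable_waitSum le_rfl hs hle
  refine ⟨fun s hs γ hγ hle p hp => ?_, fun C hC hγC => ?_⟩
  · exact existsUnique_isStationaryDist hs
      (mul_nonneg s.cast_nonneg (load_nonneg hs hle)) hp.nonneg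
      (summable_weight hf.map_zero hs hp (hsum s hs γ hγ hle))
  obtain ⟨hD, hR⟩ := hf.hasExpansions hC hγC
  obtain ⟨_, _, G, _, _, hG⟩ := hf.exists_bounds hC hγC
  -- Once `s > G²`, every `γ ∈ C` is below `√s`, so the endpoint `γ = √s` occurs only among the
  -- small `s` covered by the a priori bound.
  have hlt : ∀ᶠ x in unifAtTop C, 1 ≤ x.1 ∧ x.2 ∈ C ∧ x.2 < √(x.1 : ℝ) := by
    obtain ⟨n, hn⟩ := exists_nat_gt (G ^ 2)
    refine eventually_unifAtTop.2 ⟨n + 1, fun s hs γ hγ => ⟨by omega, hγ, ?_⟩⟩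
    refine ((le_abs_self γ).trans (hG γ hγ).2).trans_lt (Real.lt_sqrt_of_sq_lt (hn.trans_le ?_))
    exact_mod_cast (by omega : n ≤ s)
  constructor
  · obtain ⟨K, hK⟩ := hD.exists_uniform_bound
      (P := fun s γ d => ∃ p π : ℕ → ℝ, IsGlobalControl f s p ∧
        IsStationaryDist s (s * (1 - γ / √(s : ℝ))) p π ∧ d = delayProb s π)
      (by
        rintro s hs γ - d ⟨p, π, -, hπ, rfl⟩
        obtain ⟨h0, h1⟩ := hπ.delayProb_mem
        rw [abs_of_nonneg h0]
        exact h1.trans (Real.one_le_sqrt.2 (by exact_mod_cast hs)))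
      (by
        filter_upwards [hlt] with x hx
        rintro d ⟨p, π, hp, hπ, rfl⟩
        exact hπ.delayProb_eq_mul_inv hf.map_zero hx.1 hx.2.2 hp)
    exact ⟨K, fun s hs γ hγ _ p π hp hπ => hK s hs γ hγ _ ⟨p, π, hp, hπ, rfl⟩⟩
  -- The rejection probability is scaled by `√s` to be of order one; dividing back turns the error
  -- `1/s` into `1/(s√s)`. The predicate `P` ranges over all `p` and `π`, so `K` is independent of
  -- them.
  · obtain ⟨K, hK⟩ := hR.exists_uniform_bound
      (P := fun s γ d => ∃ p π : ℕ → ℝ, IsGlobalControl f s p ∧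
        IsStationaryDist s (s * (1 - γ / √(s : ℝ))) p π ∧ d = √(s : ℝ) * rejectProb s p π)
      (by
        rintro s hs γ - d ⟨p, π, hp, hπ, rfl⟩
        obtain ⟨h0, h1⟩ := hπ.rejectProb_mem hp
        rw [abs_of_nonneg (by positivity)]
        exact mul_le_of_le_one_right (Real.sqrt_nonneg _) h1)
      (by
        filter_upwards [hlt] with x hx
        rintro d ⟨p, π, hp, hπ, rfl⟩
        exact hπ.sqrt_mul_rejectProb_eq hf.map_zero hx.1 hx.2.2 hp
          (hsum _ hx.1 _ (hγC _ hx.2.1) hx.2.2.le))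
    refine ⟨K, fun s hs γ hγ _ p π hp hπ => ?_⟩
    have h := hK s hs γ hγ _ ⟨p, π, hp, hπ, rfl⟩
    have hsq : 0 < √(s : ℝ) := by positivity
    have hss : (s : ℝ) = √(s : ℝ) * √(s : ℝ) := (Real.mul_self_sqrt s.cast_nonneg).symm
    have e : √(s : ℝ) * rejectProb s p π - (T1R f γ + 1 / √(s : ℝ) * T2R f γ) =
        √(s : ℝ) * (rejectProb s p π - (1 / √(s : ℝ) * T1R f γ + 1 / (s : ℝ) * T2R f γ)) := by
      have : 1 / (s : ℝ) = 1 / √(s : ℝ) * (1 / √(s : ℝ)) := by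
        rw [one_div_mul_one_div, ← hss]
      rw [this]
      field_simp
    rw [e, abs_mul, abs_of_pos hsq, mul_comm, ← le_div_iff₀ hsq] at h
    refine h.trans (le_of_eq ?_)
    rw [mul_div_assoc, div_div]
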